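/- **Corollary (Fixed-rank approximation: Frobenius-norm error).** Let $\mathbb F$ be $\mathbb R$ or $\mathbb C$, and put $\alpha=\alpha(\mathbb R):=1$, $\alpha=\alpha(\mathbb C):=0$, and $f(s,t):=s/(t-s-\alpha)$. For $A\in\mathbb F^{m\times n}$ and an integer $j\ge 1$ let $$\tau_j(A):=\Big(\min_{\operatorname{rank}(B)<j}\|A-B\|_F^2\Big)^{1/2}$$ be the $j$th tail energy. For a matrix $M$, let $M^\dagger$ be its Moore–Penrose pseudoinverse, and let $[\![M]\!]_r$ denote any best approximation of $M$ in the Frobenius norm among the matrices of rank at most $r$ (it need not be unique). A random matrix over $\mathbb R$ is *standard normal* if its entries are independent real standard normal variables; a random matrix over $\mathbb C$ is standard normal if it has the form $G_1+\mathrm iG_2$ with $G_1,G_2$ independent real standard normal matrices. Let $A\in\mathbb F^{m\times n}$, and let $r,k,\ell$ be natural numbers with $k>r+\alpha$, $\ell>k+\alpha$ and $k\le m$. Draw independent standard normal matrices $\Omega\in\mathbb F^{n\times k}$ and $\Psi\in\mathbb F^{\ell\times m}$, and form the sketch $Y:=A\Omega$, $W:=\Psi A$. Let $Y=QR$ be an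 orthogonal–triangular factorization, where $Q\in\mathbb F^{m\times k}$ has orthonormal columns, $R\in\mathbb F^{k\times k}$ is upper triangular, and $Q$ is computed from $Y$ by a fixed (measurable) rule. Put $$X:=(\Psi Q)^\dagger W\in\mathbb F^{k\times n},\qquad \hat A:=QX .$$ Let $[\![X]\!]_r$ be a (measurable) choice of a best rank-$r$ approximation of $X$. Then $[\![\hat A]\!]_r:=Q[\![X]\!]_r$ is a best rank-$r$ approximation of $\hat A$ in the Frobenius norm, the error $\|A-[\![\hat A]\!]_r\|_F$ has finite expectation, and $$\mathbb E\,\|A-[\![\hat A]\!]_r\|_F\;\le\;\tau_{r+1}(A)+2\sqrt{1+f(k,\ell)}\;\cdot\min_{\varrho<k-\alpha}\sqrt{1+f(\varrho,k)}\;\tau_{\varrho+1}(A),$$ where $\varrho$ ranges over the natural numbers $0,1,2,\dots$ with $\varrho<k-\alpha$. -/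

import Mathlib

open MeasureTheory ProbabilityTheory
open scoped Matrix

attribute [local instance] Matrix.frobeniusNormedAddCommGroup

namespace SketchRecon

noncomputable section

/-- The number `α(𝔽)`: it is `1` for `𝔽 = ℝ` (where the imaginary unit of `RCLike` is zero)
and `0` for `𝔽 = ℂ`. -/
def alpha (𝕜 : Type*) [RCLike 𝕜] : ℕ :=
  open Classical in if (RCLike.I : 𝕜) = 0 then 1 else 0

/-- The function `f(s, t) = s / (t - s - α)`, computed in the real numbers. -/
def ratio (𝕜 : Type*) [RCLike 𝕜] (s t : ℕ) : ℝ :=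
  (s : ℝ) / ((t : ℝ) - (s : ℝ) - (alpha 𝕜 : ℝ))

/-- The (product) sigma-algebra on matrices generated by the entries. -/
instance instMeasurableSpaceMatrix {m n R : Type*} [MeasurableSpace R] :
    MeasurableSpace (Matrix m n R) :=
  inferInstanceAs (MeasurableSpace (m → n → R))

/-- The law on the scalar field of `g₁ + i g₂`, where `g₁, g₂` are independent real standard
normal variables. Over `ℝ` the imaginary unit of `RCLike` is zero, so this is the real standard
normal law `gaussianReal 0 1`; over `ℂ` the real and imaginary parts both have variance one. -/
def stdNormal (𝕜 : Type*) [RCLike 𝕜] : Measure 𝕜 :=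
  ((gaussianReal 0 1).prod (gaussianReal 0 1)).map
    (fun p : ℝ × ℝ => (p.1 : 𝕜) + (RCLike.I : 𝕜) * (p.2 : 𝕜))

/-- A random matrix has the standard normal distribution if its entries form an independent
family of standard normal scalars. -/
structure IsStdNormalMatrix {𝕜 : Type*} [RCLike 𝕜] {m n : Type*} {Ω : Type*} [MeasurableSpace Ω]
    (G : Ω → Matrix m n 𝕜) (μ : Measure Ω) : Prop where
  hasLaw : ∀ i j, HasLaw (fun ω => G ω i j) (stdNormal 𝕜) μ
  indep : iIndepFun (fun (p : m × n) (ω : Ω) => G ω p.1 p.2) μ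

/-- The squared tail energy `τ_j²(A)`, the minimum of `‖A - B‖_F²` over the matrices `B` with
`rank B < j` (for `j ≥ 1`). -/
def tailEnergySq {𝕜 : Type*} [RCLike 𝕜] {m n : ℕ} (j : ℕ) (A : Matrix (Fin m) (Fin n) 𝕜) : ℝ :=
  ⨅ B : {B : Matrix (Fin m) (Fin n) 𝕜 // B.rank < j}, ‖A - B.1‖ ^ 2

/-- The tail energy `τ_j(A)`. -/
def tailEnergy {𝕜 : Type*} [RCLike 𝕜] {m n : ℕ} (j : ℕ) (A : Matrix (Fin m) (Fin n) 𝕜) : ℝ :=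
  √(tailEnergySq j A)

/-- `B` is an optimal rank-`r` approximation of `M` in the Frobenius norm; such a `B` need not
be unique. -/
def IsBestRankApprox {𝕜 : Type*} [RCLike 𝕜] {m n : ℕ} (r : ℕ)
    (M B : Matrix (Fin m) (Fin n) 𝕜) : Prop :=
  B.rank ≤ r ∧ ∀ C : Matrix (Fin m) (Fin n) 𝕜, C.rank ≤ r → ‖M - B‖ ≤ ‖M - C‖

/-- `Q` is the orthonormal factor of an orthogonal-triangular factorization `Y = Q R`:
`Q` has orthonormal columns and `R` is upper triangular. -/
def IsOrthoFactor {𝕜 : Type*} [RCLike 𝕜] {m k : ℕ} (Y Q : Matrix (Fin m) (Fin k) 𝕜) : Prop :=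
  Qᴴ * Q = 1 ∧ ∃ R : Matrix (Fin k) (Fin k) 𝕜, R.IsUpperTriangular ∧ Y = Q * R

/-- The four Penrose conditions: `B` is the Moore-Penrose pseudoinverse of `M`. -/
structure IsMoorePenrose {𝕜 : Type*} [RCLike 𝕜] {m n : ℕ}
    (M : Matrix (Fin m) (Fin n) 𝕜) (B : Matrix (Fin n) (Fin m) 𝕜) : Prop where
  mul_mul_left : M * B * M = M
  mul_mul_right : B * M * B = B
  left_hermitian : (M * B)ᴴ = M * B
  right_hermitian : (B * M)ᴴ = B * M

theorem exists_isMoorePenrose {𝕜 : Type*} [RCLike 𝕜] {m n : ℕ} (M : Matrix (Fin m) (Fin n) 𝕜) :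
    ∃ B, IsMoorePenrose M B := by
  have hH : (Mᴴ * M).IsHermitian := Matrix.isHermitian_conjTranspose_mul_self M
  obtain ⟨P, hPH, h1, h2, h3⟩ : ∃ P : Matrix (Fin n) (Fin n) 𝕜, Pᴴ = P ∧
      (Mᴴ * M) * P * (Mᴴ * M) = Mᴴ * M ∧ P * (Mᴴ * M) * P = P ∧
      (Mᴴ * M) * P = P * (Mᴴ * M) := by
    have hs := hH.spectral_theorem
    set φ := Unitary.conjStarAlgAut 𝕜 (Matrix (Fin n) (Fin n) 𝕜) hH.eigenvectorUnitary
    set d : Fin n → 𝕜 := RCLike.ofReal ∘ hH.eigenvalues with hd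
    have hstar : ∀ i, star (d i) = d i := fun i => by simp [hd]
    refine ⟨φ (Matrix.diagonal fun i => (d i)⁻¹), ?_, ?_, ?_, ?_⟩
    · rw [← Matrix.star_eq_conjTranspose, ← map_star, Matrix.star_eq_conjTranspose,
        Matrix.diagonal_conjTranspose]
      congr 2
      ext i
      simp only [Pi.star_apply, star_inv₀, hstar]
    · rw [hs, ← map_mul, ← map_mul, Matrix.diagonal_mul_diagonal, Matrix.diagonal_mul_diagonal]
      congr 2
      ext i
      exact mul_inv_mul_cancel (d i)
    · rw [hs, ← map_mul, ← map_mul, Matrix.diagonal_mul_diagonal, Matrix.diagonal_mul_diagonal]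
      congr 2
      ext i
      simpa using mul_inv_mul_cancel (d i)⁻¹
    · rw [hs, ← map_mul, ← map_mul, Matrix.diagonal_mul_diagonal, Matrix.diagonal_mul_diagonal]
      congr 2
      ext i
      exact mul_comm _ _
  refine ⟨P * Mᴴ, ?_, ?_, ?_, ?_⟩
  · have : Mᴴ * M * (P * (Mᴴ * M) - 1) = 0 := by
      rw [Matrix.mul_sub, Matrix.mul_one, ← Matrix.mul_assoc, h1, sub_self]
    open scoped ComplexOrder in
    rw [Matrix.conjTranspose_mul_self_mul_eq_zero, Matrix.mul_sub, Matrix.mul_one,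
      sub_eq_zero] at this
    simpa only [Matrix.mul_assoc] using this
  · calc P * Mᴴ * M * (P * Mᴴ) = P * (Mᴴ * M) * P * Mᴴ := by simp only [Matrix.mul_assoc]
      _ = P * Mᴴ := by rw [h2]
  · simp only [Matrix.conjTranspose_mul, Matrix.conjTranspose_conjTranspose, hPH,
      Matrix.mul_assoc]
  · have : P * Mᴴ * M = P * (Mᴴ * M) := Matrix.mul_assoc _ _ _
    rw [this, Matrix.conjTranspose_mul, hPH, hH.eq, h3]

/-- The Moore-Penrose pseudoinverse `M†`. -/
def pinv {𝕜 : Type*} [RCLike 𝕜] {m n : ℕ} (M : Matrix (Fin m) (Fin n) 𝕜) :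
    Matrix (Fin n) (Fin m) 𝕜 :=
  (exists_isMoorePenrose M).choose

theorem pinv_spec {𝕜 : Type*} [RCLike 𝕜] {m n : ℕ} (M : Matrix (Fin m) (Fin n) 𝕜) :
    IsMoorePenrose M (pinv M) :=
  (exists_isMoorePenrose M).choose_spec

theorem IsMoorePenrose.unique {𝕜 : Type*} [RCLike 𝕜] {m n : ℕ} {M : Matrix (Fin m) (Fin n) 𝕜}
    {B C : Matrix (Fin n) (Fin m) 𝕜} (hB : IsMoorePenrose M B) (hC : IsMoorePenrose M C) :
    B = C := by
  have e1 : M * B = M * C := by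
    calc M * B = (M * B)ᴴ := hB.left_hermitian.symm
      _ = (M * C * (M * B))ᴴ := by rw [← Matrix.mul_assoc, hC.mul_mul_left]
      _ = M * B * (M * C) := by
        rw [Matrix.conjTranspose_mul, hB.left_hermitian, hC.left_hermitian]
      _ = M * C := by rw [← Matrix.mul_assoc, hB.mul_mul_left]
  have e2 : B * M = C * M := by
    calc B * M = (B * M)ᴴ := hB.right_hermitian.symm
      _ = (B * M * (C * M))ᴴ := by
        rw [Matrix.mul_assoc, ← Matrix.mul_assoc M, hC.mul_mul_left]
      _ = C * M * (B * M) := by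
        rw [Matrix.conjTranspose_mul, hB.right_hermitian, hC.right_hermitian]
      _ = C * M := by rw [Matrix.mul_assoc, ← Matrix.mul_assoc M, hB.mul_mul_left]
  calc B = B * M * B := hB.mul_mul_right.symm
    _ = C * M * B := by rw [e2]
    _ = C * M * C := by rw [Matrix.mul_assoc, e1, ← Matrix.mul_assoc]
    _ = C := hC.mul_mul_right

/-- The factor `X = (Ψ Q)† W` computed from the co-range sketch `W`. -/
def factorX {𝕜 : Type*} [RCLike 𝕜] {m n k l : ℕ} (Ψ : Matrix (Fin l) (Fin m) 𝕜)
    (Q : Matrix (Fin m) (Fin k) 𝕜) (W : Matrix (Fin l) (Fin n) 𝕜) : Matrix (Fin k) (Fin n) 𝕜 :=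
  pinv (Ψ * Q) * W

end

end SketchRecon

open SketchRecon

namespace SketchRecon

/-! ### Scalar Gaussians, real and complex at once -/

section Scalar

variable {𝕜 : Type*} [RCLike 𝕜]

/-! Since `Q * Xr` is a best rank-`r` approximation of `Q * X`, two triangle inequalities give `‖A -
Q * Xr‖ ≤ ‖A - B‖ + 2 * ‖A - Q * X‖` for every `B` of rank at most `r`. It remains to bound the
expected error of the unreduced reconstruction `Q * X`, for which second moments suffice: E Z ≤ √(E
Z²).

Fix Ω, hence Q. Computing X is a Gaussian least-squares problem with orthonormal design Q. Its
squared error is the squared residual ‖A - QQᴴA‖² plus a term ‖(ΨQ)†ΨC‖² with C = A - QQᴴA. Because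
QᴴC = 0, ΨQ and ΨC are independent, so the second term has mean at most f(k, ℓ)‖C‖²
(`lintegral_norm_sq_leftInv_mul_le`). The mean of ‖C‖² over Ω is controlled by the same estimate
applied to Aᴴ, with design an orthonormal basis of the range of Bᴴ, rank B ≤ ϱ
(`lintegral_norm_sq_rangeFinder_le`).

The core is E‖G†‖² ≤ f(s, t)/(2 - α) for a t × s Gaussian G (`lintegral_norm_sq_leftInv_le`). A row
of G† has squared norm at most 1/‖Bg‖², where g is the matching column and B is a coisometry killing
the other columns. Given those columns, Bg is Gaussian in t - s + 1 dimensions, and its inverse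
square moment follows from the Laplace transform of ‖·‖². All independence and invariance is read
off from characteristic functions. -/

theorem alpha_le_one : alpha 𝕜 ≤ 1 := by
  unfold alpha
  split_ifs <;> simp

/-- Lets one computation serve both fields: the weight 1 - α switches the imaginary part off over ℝ.
-/
theorem im_I_sq : (RCLike.im (RCLike.I : 𝕜)) ^ 2 = 1 - (alpha 𝕜 : ℝ) := by
  unfold alpha
  split_ifs with h
  · simp [h]
  · have h1 := congrArg RCLike.re (RCLike.I_mul_I_of_nonzero h)
    simp only [RCLike.mul_re, RCLike.I_re, map_neg, RCLike.one_re] at h1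
    push_cast
    linear_combination -h1

theorem norm_sq_add_I_mul (a b : ℝ) :
    ‖(a : 𝕜) + RCLike.I * (b : 𝕜)‖ ^ 2 = a ^ 2 + (1 - (alpha 𝕜 : ℝ)) * b ^ 2 := by
  rw [← im_I_sq, ← RCLike.normSq_eq_def', RCLike.normSq_apply]
  simp
  ring

theorem re_conj_mul_add_I_mul (x : 𝕜) (a b : ℝ) :
    RCLike.re (star x * ((a : 𝕜) + RCLike.I * (b : 𝕜))) =
      RCLike.re x * a + RCLike.im x * b := by
  have h := RCLike.mul_im_I_ax x
  simp [mul_add, RCLike.mul_re]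
  -- `h` says im x · im I = im x, so either im x = 0 or im I = 1.
  rcases eq_or_ne (RCLike.im x) 0 with h0 | h0
  · exact Or.inr h0
  · exact Or.inl (by rw [mul_right_eq_self₀.1 h |>.resolve_right h0, one_mul])

theorem measurable_stdNormal_map :
    Measurable (fun p : ℝ × ℝ => (p.1 : 𝕜) + (RCLike.I : 𝕜) * (p.2 : 𝕜)) := by
  fun_prop

instance : IsProbabilityMeasure (stdNormal 𝕜) :=
  Measure.isProbabilityMeasure_map measurable_stdNormal_map.aemeasurable

theorem integral_cexp_stdNormal (x : 𝕜) :
    ∫ g, Complex.exp ((RCLike.re (star x * g) : ℝ) * Complex.I) ∂stdNormal 𝕜 =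
      Complex.exp (-((‖x‖ ^ 2 : ℝ) / 2 : ℂ)) := by
  rw [stdNormal, integral_map measurable_stdNormal_map.aemeasurable
    (Measurable.aestronglyMeasurable (by fun_prop))]
  simp_rw [re_conj_mul_add_I_mul]
  push_cast
  simp_rw [add_mul, Complex.exp_add]
  rw [integral_prod_mul (fun a : ℝ => Complex.exp (RCLike.re x * a * Complex.I))
    (fun b : ℝ => Complex.exp (RCLike.im x * b * Complex.I)), ← charFun_apply_real,
    ← charFun_apply_real, charFun_gaussianReal, charFun_gaussianReal, ← Complex.exp_add]
  congr 1
  have h := congrArg (Complex.ofReal) ((RCLike.normSq_eq_def' x).symm.trans (RCLike.normSq_apply x))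
  push_cast at h ⊢
  linear_combination (1 / 2 : ℂ) * h

theorem integral_exp_sq_gaussianReal {u : ℝ} (hu : 0 ≤ u) :
    ∫ a, Real.exp (-(u / 2) * a ^ 2) ∂gaussianReal 0 1 = (1 + u) ^ (-(1 / 2) : ℝ) := by
  rw [integral_gaussianReal_eq_integral_smul one_ne_zero]
  simp only [gaussianPDFReal, smul_eq_mul, mul_assoc, ← Real.exp_add]
  rw [integral_const_mul]
  have h : ∀ x : ℝ, -(x - 0) ^ 2 / (2 * ((1 : NNReal) : ℝ)) + -(u / 2) * x ^ 2 =
      -((1 + u) / 2) * x ^ 2 := fun x => by push_cast; ring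
  simp_rw [h]
  rw [integral_gaussian, ← Real.sqrt_inv, ← Real.sqrt_mul (by positivity), Real.rpow_neg
    (by positivity), ← Real.sqrt_eq_rpow, ← Real.sqrt_inv]
  congr 1
  push_cast
  have := Real.pi_ne_zero
  field_simp

theorem integral_sq_gaussianReal : ∫ a, a ^ 2 ∂gaussianReal 0 1 = 1 := by
  have := variance_fun_id_gaussianReal (μ := 0) (v := 1)
  rw [variance_of_integral_eq_zero (by fun_prop) (by simp)] at this
  simpa using this

/-- Each real coordinate contributes a factor (1 + u)^(-1/2), and 2 - α is the real dimension of the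
field. -/
theorem integral_exp_norm_sq_stdNormal {u : ℝ} (hu : 0 ≤ u) :
    ∫ g, Real.exp (-(u / 2) * ‖g‖ ^ 2) ∂stdNormal 𝕜 =
      (1 + u) ^ (-((2 - alpha 𝕜) / 2) : ℝ) := by
  rw [stdNormal, integral_map measurable_stdNormal_map.aemeasurable
    (Measurable.aestronglyMeasurable (by fun_prop))]
  simp_rw [norm_sq_add_I_mul, mul_add, Real.exp_add]
  rw [integral_prod_mul (fun a : ℝ => Real.exp (-(u / 2) * a ^ 2))
    (fun b : ℝ => Real.exp (-(u / 2) * ((1 - (alpha 𝕜 : ℝ)) * b ^ 2))),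
    integral_exp_sq_gaussianReal hu]
  have h1 := alpha_le_one (𝕜 := 𝕜)
  interval_cases h : alpha 𝕜
  · norm_num
    have := integral_exp_sq_gaussianReal hu
    norm_num at this
    rw [this, ← Real.rpow_add (by linarith)]
    norm_num
  · norm_num

theorem lintegral_norm_sq_stdNormal :
    ∫⁻ g, ENNReal.ofReal (‖g‖ ^ 2) ∂stdNormal 𝕜 = ENNReal.ofReal (2 - alpha 𝕜) := by
  have hi : Integrable (fun a : ℝ => a ^ 2) (gaussianReal 0 1) :=
    (memLp_id_gaussianReal 2).integrable_sq
  have hα : (alpha 𝕜 : ℝ) ≤ 1 := by exact_mod_cast alpha_le_one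
  rw [stdNormal, lintegral_map (by fun_prop) measurable_stdNormal_map]
  simp_rw [norm_sq_add_I_mul]
  have h1 : Integrable (fun p : ℝ × ℝ => p.1 ^ 2)
    ((gaussianReal 0 1).prod (gaussianReal 0 1)) := hi.comp_fst _
  have h2 : Integrable (fun p : ℝ × ℝ => (1 - (alpha 𝕜 : ℝ)) * p.2 ^ 2)
    ((gaussianReal 0 1).prod (gaussianReal 0 1)) := (hi.comp_snd _).const_mul _
  rw [← ofReal_integral_eq_lintegral_ofReal (f := fun p : ℝ × ℝ => p.1 ^ 2 +
    (1 - (alpha 𝕜 : ℝ)) * p.2 ^ 2) (h1.add h2)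
    (ae_of_all _ fun p => by
      have := sub_nonneg.2 hα
      simp only [Pi.zero_apply]; positivity)]
  congr 1
  rw [integral_add h1 h2, integral_const_mul, integral_fun_fst (fun a : ℝ => a ^ 2),
    integral_fun_snd (fun a : ℝ => a ^ 2)]
  simp [integral_sq_gaussianReal]
  ring

end Scalar

/-! ### Entrywise measurability of matrix operations -/

section Measurability

variable {𝕜 : Type*} [RCLike 𝕜]

theorem measurable_matrix_iff {S R m n : Type*} [MeasurableSpace S] [MeasurableSpace R]
    {f : S → Matrix m n R} : Measurable f ↔ ∀ i j, Measurable fun s => f s i j := by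
  constructor
  · intro h i j
    exact (measurable_pi_apply j).comp ((measurable_pi_apply (X := fun _ : m => n → R) i).comp h)
  · intro h
    exact measurable_pi_lambda (X := fun _ : m => n → R) f fun i =>
      measurable_pi_lambda _ fun j => h i j

theorem measurable_matrix_entry {R m n : Type*} [MeasurableSpace R] (i : m) (j : n) :
    Measurable fun M : Matrix m n R => M i j :=
  measurable_matrix_iff.1 measurable_id i j

theorem Measurable.matrix_mul {S : Type*} [MeasurableSpace S] {l m n : Type*} [Fintype l]
    {f : S → Matrix m l 𝕜} {g : S → Matrix l n 𝕜} (hf : Measurable f) (hg : Measurable g) :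
    Measurable fun s => f s * g s := by
  refine measurable_matrix_iff.2 fun i j => ?_
  simp only [Matrix.mul_apply]
  exact Finset.measurable_fun_sum _ fun a _ =>
    (measurable_matrix_iff.1 hf i a).mul (measurable_matrix_iff.1 hg a j)

theorem Measurable.matrix_add {S : Type*} [MeasurableSpace S] {m n : Type*}
    {f g : S → Matrix m n 𝕜} (hf : Measurable f) (hg : Measurable g) :
    Measurable fun s => f s + g s :=
  measurable_matrix_iff.2 fun i j =>
    (measurable_matrix_iff.1 hf i j).add (measurable_matrix_iff.1 hg i j)

theorem Measurable.matrix_sub {S : Type*} [MeasurableSpace S] {m n : Type*}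
    {f g : S → Matrix m n 𝕜} (hf : Measurable f) (hg : Measurable g) :
    Measurable fun s => f s - g s :=
  measurable_matrix_iff.2 fun i j =>
    (measurable_matrix_iff.1 hf i j).sub (measurable_matrix_iff.1 hg i j)

theorem Measurable.matrix_conjTranspose {S : Type*} [MeasurableSpace S] {m n : Type*}
    {f : S → Matrix m n 𝕜} (hf : Measurable f) : Measurable fun s => (f s)ᴴ := by
  refine measurable_matrix_iff.2 fun i j => ?_
  simp only [Matrix.conjTranspose_apply, RCLike.star_def]
  exact RCLike.continuous_conj.measurable.comp (measurable_matrix_iff.1 hf j i)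

end Measurability

/-! ### Frobenius norm as a sum and as a trace -/

section Frobenius

variable {𝕜 : Type*} [RCLike 𝕜] {p q : Type*} [Fintype p] [Fintype q]

theorem frobenius_norm_sq (M : Matrix p q 𝕜) : ‖M‖ ^ 2 = ∑ i, ∑ j, ‖M i j‖ ^ 2 := by
  rw [Matrix.frobenius_norm_def, ← Real.sqrt_eq_rpow, Real.sq_sqrt (by positivity)]
  simp

theorem frobenius_norm_sq_eq_trace (M : Matrix p q 𝕜) :
    ‖M‖ ^ 2 = RCLike.re (Mᴴ * M).trace := by
  rw [frobenius_norm_sq, Matrix.trace, Finset.sum_comm, map_sum]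
  refine Finset.sum_congr rfl fun j _ => ?_
  rw [Matrix.diag_apply, Matrix.mul_apply, map_sum]
  refine Finset.sum_congr rfl fun i _ => ?_
  rw [Matrix.conjTranspose_apply, RCLike.star_def, RCLike.conj_mul]
  norm_cast

theorem re_trace_conjTranspose_mul (X G : Matrix p q 𝕜) :
    RCLike.re (Xᴴ * G).trace = ∑ i, ∑ j, RCLike.re (star (X i j) * G i j) := by
  rw [Matrix.trace, Finset.sum_comm, map_sum]
  refine Finset.sum_congr rfl fun j _ => ?_
  rw [Matrix.diag_apply, Matrix.mul_apply, map_sum]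
  rfl

theorem measurable_matrix_det [DecidableEq p] :
    Measurable fun M : Matrix p p 𝕜 => M.det := by
  simp only [Matrix.det_apply]
  exact Finset.measurable_fun_sum _ fun σ _ => Measurable.const_smul
    (Finset.measurable_fun_prod _ fun i _ => measurable_matrix_entry _ _) _

theorem measurable_matrix_inv [DecidableEq p] :
    Measurable fun M : Matrix p p 𝕜 => M⁻¹ := by
  refine measurable_matrix_iff.2 fun i j => ?_
  simp only [Matrix.inv_def, Ring.inverse_eq_inv', Matrix.smul_apply, smul_eq_mul,
    Matrix.adjugate_apply]
  refine measurable_matrix_det.inv.mul (measurable_matrix_det.comp ?_)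
  refine measurable_matrix_iff.2 fun a b => ?_
  simp only [Matrix.updateRow_apply]
  split_ifs
  · exact measurable_const
  · exact measurable_matrix_entry _ _

theorem Measurable.frobenius_norm {S : Type*} [MeasurableSpace S]
    {f : S → Matrix p q 𝕜} (hf : Measurable f) : Measurable fun s => ‖f s‖ := by
  have : (fun s => ‖f s‖) = fun s => √(∑ i, ∑ j, ‖f s i j‖ ^ 2) := by
    funext s
    rw [← frobenius_norm_sq, Real.sqrt_sq (norm_nonneg _)]
  rw [this]
  exact (Finset.measurable_fun_sum _ fun i _ => Finset.measurable_fun_sum _ fun j _ =>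
    (measurable_matrix_iff.1 hf i j).norm.pow_const 2).sqrt

end Frobenius

/-! ### The standard normal matrix law and its characteristic function -/

section MatrixLaw

variable {𝕜 : Type*} [RCLike 𝕜] {p q : Type*}

theorem measurable_matrix_of :
    Measurable fun (g : p × q → 𝕜) => (Matrix.of fun i j => g (i, j) : Matrix p q 𝕜) :=
  measurable_matrix_iff.2 fun i j => measurable_pi_apply (i, j)

variable [Fintype p] [Fintype q]

variable (𝕜 p q) in
/-- The law of a standard normal matrix. -/
noncomputable def stdNormalMatrix : Measure (Matrix p q 𝕜) :=
  (Measure.pi fun _ : p × q => stdNormal 𝕜).map fun g => Matrix.of fun i j => g (i, j)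

instance : IsProbabilityMeasure (stdNormalMatrix 𝕜 p q) :=
  Measure.isProbabilityMeasure_map measurable_matrix_of.aemeasurable

theorem IsStdNormalMatrix.hasLaw_stdNormalMatrix {S : Type*} [MeasurableSpace S] {μ : Measure S}
    [IsProbabilityMeasure μ] {G : S → Matrix p q 𝕜} (h : IsStdNormalMatrix G μ) :
    HasLaw G (stdNormalMatrix 𝕜 p q) μ := by
  have hm : ∀ x : p × q, AEMeasurable (fun s => G s x.1 x.2) μ :=
    fun x => (h.hasLaw x.1 x.2).aemeasurable
  have h1 := (iIndepFun_iff_map_fun_eq_pi_map hm).1 h.indep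
  simp_rw [fun x : p × q => (h.hasLaw x.1 x.2).map_eq] at h1
  have h2 : G = (fun g : p × q → 𝕜 => (Matrix.of fun i j => g (i, j) : Matrix p q 𝕜)) ∘
    fun s x => G s x.1 x.2 := rfl
  refine ⟨?_, ?_⟩
  · rw [h2]
    exact measurable_matrix_of.comp_aemeasurable (aemeasurable_pi_lambda _ hm)
  · rw [stdNormalMatrix, ← h1, AEMeasurable.map_map_of_aemeasurable
      measurable_matrix_of.aemeasurable (aemeasurable_pi_lambda _ hm)]
    rfl

theorem integral_cexp_stdNormalMatrix (X : Matrix p q 𝕜) :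
    ∫ G, Complex.exp ((RCLike.re (Xᴴ * G).trace : ℝ) * Complex.I) ∂stdNormalMatrix 𝕜 p q =
      Complex.exp (-((‖X‖ ^ 2 : ℝ) / 2 : ℂ)) := by
  have hm : Measurable fun G : Matrix p q 𝕜 =>
      Complex.exp ((RCLike.re (Xᴴ * G).trace : ℝ) * Complex.I) := by
    simp_rw [re_trace_conjTranspose_mul]
    have := fun i j => measurable_matrix_entry (R := 𝕜) (m := p) (n := q) i j
    fun_prop
  rw [stdNormalMatrix, integral_map measurable_matrix_of.aemeasurable hm.aestronglyMeasurable]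
  simp_rw [re_trace_conjTranspose_mul, Matrix.of_apply, ← Fintype.sum_prod_type'
    (f := fun i j => RCLike.re (star (X i j) * _)), frobenius_norm_sq, ← Fintype.sum_prod_type'
    (f := fun i j => ‖X i j‖ ^ 2)]
  push_cast
  simp_rw [Finset.sum_mul, Complex.exp_sum, Finset.sum_div, ← Finset.sum_neg_distrib,
    Complex.exp_sum]
  rw [integral_fintype_prod_eq_prod (fun (x : p × q) (g : 𝕜) =>
    Complex.exp ((RCLike.re (star (X x.1 x.2) * g) : ℝ) * Complex.I))]
  refine Finset.prod_congr rfl fun x _ => ?_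
  rw [integral_cexp_stdNormal]
  push_cast
  rfl

/-- Shows that trace pairings exhaust the real dual, so they suffice to test equality of measures.
The coefficients of X are the values of L on the unit vectors in the directions 1 and I. -/
theorem exists_re_trace_eq (L : StrongDual ℝ (p × q → 𝕜)) : ∃ X : Matrix p q 𝕜,
    ∀ G : Matrix p q 𝕜, L (fun x => G x.1 x.2) = RCLike.re (Xᴴ * G).trace := by
  classical
  refine ⟨Matrix.of fun i j => (L (Pi.single (i, j) 1) : 𝕜) +
    RCLike.I * (L (Pi.single (i, j) RCLike.I) : 𝕜), fun G => ?_⟩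
  rw [re_trace_conjTranspose_mul, ← Fintype.sum_prod_type'
    (f := fun i j => RCLike.re (star ((Matrix.of fun i j => (L (Pi.single (i, j) 1) : 𝕜) +
    RCLike.I * (L (Pi.single (i, j) RCLike.I) : 𝕜)) i j) * G i j)), ← L.sum_comp_single]
  refine Finset.sum_congr rfl fun x _ => ?_
  obtain ⟨i, j⟩ := x
  simp only [Matrix.of_apply, ContinuousLinearMap.comp_apply, ContinuousLinearMap.single_apply]
  generalize G i j = z
  have h1 : (Pi.single (i, j) z : p × q → 𝕜) = RCLike.re z • (Pi.single (i, j) 1 : p × q → 𝕜) +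
      RCLike.im z • (Pi.single (i, j) RCLike.I : p × q → 𝕜) := by
    rw [← Pi.single_smul, ← Pi.single_smul, ← Pi.single_add]
    congr 1
    simp [RCLike.real_smul_eq_coe_mul, RCLike.re_add_im]
  have h2 := re_conj_mul_add_I_mul z (L (Pi.single (i, j) 1)) (L (Pi.single (i, j) RCLike.I))
  rw [h1, map_add, map_smul, map_smul, smul_eq_mul, smul_eq_mul, ← h2, ← RCLike.conj_re]
  simp [mul_comm]

/-- Uniqueness of characteristic functions, transported from functions on `p × q` by flattening. -/
theorem matrix_measure_ext {μ ν : Measure (Matrix p q 𝕜)} [IsFiniteMeasure μ] [IsFiniteMeasure ν]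
    (h : ∀ X : Matrix p q 𝕜,
      ∫ G, Complex.exp ((RCLike.re (Xᴴ * G).trace : ℝ) * Complex.I) ∂μ =
        ∫ G, Complex.exp ((RCLike.re (Xᴴ * G).trace : ℝ) * Complex.I) ∂ν) : μ = ν := by
  have he : Measurable fun (G : Matrix p q 𝕜) (x : p × q) => G x.1 x.2 :=
    measurable_pi_lambda _ fun x => measurable_matrix_entry _ _
  have hμ : ∀ ρ : Measure (Matrix p q 𝕜), (ρ.map fun (G : Matrix p q 𝕜) (x : p × q) =>
      G x.1 x.2).map (fun g => (Matrix.of fun i j => g (i, j) : Matrix p q 𝕜)) = ρ := fun ρ => by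
    rw [Measure.map_map measurable_matrix_of he]
    exact Measure.map_id
  rw [← hμ μ, ← hμ ν]
  congr 1
  refine Measure.ext_of_charFunDual (funext fun L => ?_)
  obtain ⟨X, hX⟩ := exists_re_trace_eq L
  have hc : Continuous fun v : p × q → 𝕜 => Complex.exp (L v * Complex.I) := by fun_prop
  rw [charFunDual_apply, charFunDual_apply, integral_map he.aemeasurable
    hc.aestronglyMeasurable, integral_map he.aemeasurable hc.aestronglyMeasurable]
  simp_rw [hX]
  exact h X

end MatrixLaw

/-! ### Invariance and independent splitting of Gaussian matrices -/

section Invariance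

variable {𝕜 : Type*} [RCLike 𝕜] {p q p' q' : Type*} [Fintype p] [Fintype q]
  [Fintype p'] [Fintype q']

theorem measurable_cexp_re_trace (X : Matrix p q 𝕜) :
    Measurable fun G : Matrix p q 𝕜 =>
      Complex.exp ((RCLike.re (Xᴴ * G).trace : ℝ) * Complex.I) := by
  simp_rw [re_trace_conjTranspose_mul]
  have := fun i j => measurable_matrix_entry (R := 𝕜) (m := p) (n := q) i j
  fun_prop

/-- The standard normal law is invariant under maps with an isometric formal adjoint. -/
theorem map_stdNormalMatrix {T : Matrix p q 𝕜 → Matrix p' q' 𝕜} (hT : Measurable T)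
    (T' : Matrix p' q' 𝕜 → Matrix p q 𝕜)
    (hadj : ∀ X G, RCLike.re (Xᴴ * T G).trace = RCLike.re ((T' X)ᴴ * G).trace)
    (hiso : ∀ X, ‖T' X‖ ^ 2 = ‖X‖ ^ 2) :
    (stdNormalMatrix 𝕜 p q).map T = stdNormalMatrix 𝕜 p' q' := by
  have := Measure.isProbabilityMeasure_map (μ := stdNormalMatrix 𝕜 p q) hT.aemeasurable
  refine matrix_measure_ext fun X => ?_
  rw [integral_map hT.aemeasurable (measurable_cexp_re_trace X).aestronglyMeasurable]
  simp_rw [hadj]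
  rw [integral_cexp_stdNormalMatrix, integral_cexp_stdNormalMatrix, hiso]

theorem map_conjTranspose_stdNormalMatrix :
    (stdNormalMatrix 𝕜 p q).map Matrix.conjTranspose = stdNormalMatrix 𝕜 q p := by
  refine map_stdNormalMatrix (Measurable.matrix_conjTranspose measurable_id)
    Matrix.conjTranspose (fun X G => ?_) (fun X => by rw [Matrix.frobenius_norm_conjTranspose])
  rw [← Matrix.conjTranspose_mul, Matrix.trace_conjTranspose, RCLike.star_def, RCLike.conj_re,
    Matrix.trace_mul_comm, Matrix.conjTranspose_conjTranspose]

theorem map_mul_left_stdNormalMatrix [DecidableEq p'] {B : Matrix p' p 𝕜} (hB : B * Bᴴ = 1) :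
    (stdNormalMatrix 𝕜 p q).map (fun G => B * G) = stdNormalMatrix 𝕜 p' q := by
  refine map_stdNormalMatrix (Measurable.matrix_mul measurable_const measurable_id)
    (fun X => Bᴴ * X) (fun X G => ?_) (fun X => ?_)
  · rw [Matrix.conjTranspose_mul, Matrix.conjTranspose_conjTranspose, Matrix.mul_assoc]
  · rw [frobenius_norm_sq_eq_trace, frobenius_norm_sq_eq_trace, Matrix.conjTranspose_mul,
      Matrix.conjTranspose_conjTranspose, Matrix.mul_assoc, ← Matrix.mul_assoc B, hB,
      Matrix.one_mul]

theorem re_trace_conjTranspose_mul_mul {r : Type*} [Fintype r] (X : Matrix p q 𝕜)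
    (P : Matrix r q 𝕜) (G : Matrix p r 𝕜) :
    RCLike.re (Xᴴ * (G * P)).trace = RCLike.re ((X * Pᴴ)ᴴ * G).trace := by
  rw [Matrix.conjTranspose_mul, Matrix.conjTranspose_conjTranspose, ← Matrix.mul_assoc,
    Matrix.trace_mul_comm, Matrix.mul_assoc]

theorem norm_sq_mul_conjTranspose {r : Type*} [Fintype r] (X : Matrix p q 𝕜) (P : Matrix r q 𝕜) :
    ‖X * Pᴴ‖ ^ 2 = RCLike.re (Xᴴ * X * (Pᴴ * P)).trace := by
  rw [frobenius_norm_sq_eq_trace, Matrix.conjTranspose_mul, Matrix.conjTranspose_conjTranspose,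
    Matrix.mul_assoc, Matrix.trace_mul_comm]
  simp only [Matrix.mul_assoc]

/-- A standard normal matrix splits into independent parts along complementary isometries. -/
theorem map_mul_add_mul_stdNormalMatrix {q₁ q₂ : Type*} [Fintype q₁] [Fintype q₂] [DecidableEq q]
    {P₁ : Matrix q₁ q 𝕜} {P₂ : Matrix q₂ q 𝕜} (hP : P₁ᴴ * P₁ + P₂ᴴ * P₂ = 1) :
    ((stdNormalMatrix 𝕜 p q₁).prod (stdNormalMatrix 𝕜 p q₂)).map
      (fun x => x.1 * P₁ + x.2 * P₂) = stdNormalMatrix 𝕜 p q := by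
  have hT : Measurable fun x : Matrix p q₁ 𝕜 × Matrix p q₂ 𝕜 => x.1 * P₁ + x.2 * P₂ :=
    (measurable_fst.matrix_mul measurable_const).matrix_add
      (measurable_snd.matrix_mul measurable_const)
  have := Measure.isProbabilityMeasure_map (μ := (stdNormalMatrix 𝕜 p q₁).prod
    (stdNormalMatrix 𝕜 p q₂)) hT.aemeasurable
  refine matrix_measure_ext fun X => ?_
  rw [integral_map hT.aemeasurable (measurable_cexp_re_trace X).aestronglyMeasurable]
  simp_rw [Matrix.mul_add, Matrix.trace_add, map_add, re_trace_conjTranspose_mul_mul,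
    Complex.ofReal_add, add_mul, Complex.exp_add]
  rw [integral_prod_mul (fun G : Matrix p q₁ 𝕜 =>
      Complex.exp ((RCLike.re ((X * P₁ᴴ)ᴴ * G).trace : ℝ) * Complex.I))
    (fun G : Matrix p q₂ 𝕜 =>
      Complex.exp ((RCLike.re ((X * P₂ᴴ)ᴴ * G).trace : ℝ) * Complex.I)),
    integral_cexp_stdNormalMatrix, integral_cexp_stdNormalMatrix, integral_cexp_stdNormalMatrix,
    ← Complex.exp_add]
  -- Pythagoras for the complementary parts: the exponents of the two characteristic functions add
  -- up to the right one.
  have hn : ‖X * P₁ᴴ‖ ^ 2 + ‖X * P₂ᴴ‖ ^ 2 = ‖X‖ ^ 2 := by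
    rw [norm_sq_mul_conjTranspose, norm_sq_mul_conjTranspose, ← map_add, ← Matrix.trace_add,
      ← Matrix.mul_add, hP, Matrix.mul_one,
      frobenius_norm_sq_eq_trace]
  rw [← hn]
  push_cast
  ring_nf

end Invariance

/-! ### Second moments and inverse second moments -/

section Moments

variable {𝕜 : Type*} [RCLike 𝕜] {p q : Type*} [Fintype p] [Fintype q]

theorem integral_exp_norm_sq_stdNormalMatrix {u : ℝ} (hu : 0 ≤ u) :
    ∫ G, Real.exp (-(u / 2) * ‖G‖ ^ 2) ∂stdNormalMatrix 𝕜 p q =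
      (1 + u) ^ (-(Fintype.card p * Fintype.card q * (2 - alpha 𝕜) / 2) : ℝ) := by
  have hm : Measurable fun G : Matrix p q 𝕜 => Real.exp (-(u / 2) * ‖G‖ ^ 2) :=
    (((Measurable.frobenius_norm measurable_id).pow_const 2).const_mul _).exp
  rw [stdNormalMatrix, integral_map measurable_matrix_of.aemeasurable hm.aestronglyMeasurable]
  simp_rw [frobenius_norm_sq, Matrix.of_apply, ← Fintype.sum_prod_type'
    (f := fun i j => ‖_‖ ^ 2), Finset.mul_sum, Real.exp_sum]
  rw [integral_fintype_prod_eq_prod (fun (_ : p × q) (g : 𝕜) => Real.exp (-(u / 2) * ‖g‖ ^ 2))]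
  simp_rw [integral_exp_norm_sq_stdNormal hu]
  rw [Finset.prod_const, Finset.card_univ, Fintype.card_prod, ← Real.rpow_natCast,
    ← Real.rpow_mul (by linarith)]
  congr 1
  push_cast
  ring

theorem lintegral_norm_sq_entry (i : p) (j : q) :
    ∫⁻ G, ENNReal.ofReal (‖G i j‖ ^ 2) ∂stdNormalMatrix 𝕜 p q = ENNReal.ofReal (2 - alpha 𝕜) := by
  have hm : Measurable fun G : Matrix p q 𝕜 => ENNReal.ofReal (‖G i j‖ ^ 2) :=
    ((measurable_matrix_entry i j).norm.pow_const 2).ennreal_ofReal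
  rw [stdNormalMatrix, lintegral_map hm measurable_matrix_of, ← lintegral_norm_sq_stdNormal]
  exact (measurePreserving_eval (fun _ : p × q => stdNormal 𝕜) (i, j)).lintegral_comp
    (f := fun g => ENNReal.ofReal (‖g‖ ^ 2)) (by fun_prop)

/-- For X ≠ 0 the pairing divided by ‖X‖ is a 1 × 1 standard normal matrix, by invariance. -/
theorem lintegral_norm_sq_trace_mul (X : Matrix p q 𝕜) :
    ∫⁻ G, ENNReal.ofReal (‖(Xᴴ * G).trace‖ ^ 2) ∂stdNormalMatrix 𝕜 p q =
      ENNReal.ofReal ((2 - alpha 𝕜) * ‖X‖ ^ 2) := by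
  rcases eq_or_ne X 0 with rfl | hX
  · simp
  have hX' : ‖X‖ ≠ 0 := norm_ne_zero_iff.2 hX
  set T : Matrix p q 𝕜 → Matrix Unit Unit 𝕜 := fun G =>
    Matrix.of fun _ _ => ((‖X‖⁻¹ : ℝ) : 𝕜) * (Xᴴ * G).trace with hTdef
  have hT : Measurable T := by
    refine measurable_matrix_iff.2 fun _ _ => Measurable.const_mul ?_ _
    exact Finset.measurable_fun_sum _ fun j _ => measurable_matrix_iff.1
      (Measurable.matrix_mul measurable_const measurable_id) j j
  have hlaw := map_stdNormalMatrix hT (fun c => (((‖X‖⁻¹ : ℝ) : 𝕜) * c () ()) • X)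
    (fun c G => by
      simp only [Matrix.conjTranspose_smul, Matrix.smul_mul, Matrix.trace_smul, smul_eq_mul]
      simp [hTdef, Matrix.trace, Matrix.mul_apply, mul_comm, mul_left_comm])
    (fun c => by
      rw [frobenius_norm_sq, frobenius_norm_sq c]
      simp only [Matrix.smul_apply, smul_eq_mul, norm_mul, mul_pow, ← Finset.mul_sum]
      rw [← frobenius_norm_sq]
      simp
      field_simp)
  have hm : Measurable fun c : Matrix Unit Unit 𝕜 => ENNReal.ofReal (‖c () ()‖ ^ 2) :=
    ((measurable_matrix_entry () ()).norm.pow_const 2).ennreal_ofReal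
  have h1 := lintegral_norm_sq_entry (𝕜 := 𝕜) () ()
  rw [← hlaw, lintegral_map hm hT] at h1
  rw [mul_comm, ENNReal.ofReal_mul (by positivity), ← h1,
    ← lintegral_const_mul _ (f := fun G => ENNReal.ofReal (‖T G () ()‖ ^ 2)) (hm.comp hT)]
  refine lintegral_congr fun G => ?_
  rw [← ENNReal.ofReal_mul (by positivity)]
  congr 1
  simp [hTdef, mul_pow]
  field_simp

/-- Each entry of DGC is the trace pairing of G with a rank-one matrix built from a row of D and a
column of C, whose norm is the product of theirs; summing the entries factors. -/
theorem lintegral_norm_sq_mul_mul {p' q' : Type*} [Fintype p'] [Fintype q'] (D : Matrix p' p 𝕜)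
    (C : Matrix q q' 𝕜) :
    ∫⁻ G, ENNReal.ofReal (‖D * G * C‖ ^ 2) ∂stdNormalMatrix 𝕜 p q =
      ENNReal.ofReal ((2 - alpha 𝕜) * ‖D‖ ^ 2 * ‖C‖ ^ 2) := by
  have hα : (0 : ℝ) ≤ 2 - alpha 𝕜 := by
    have : (alpha 𝕜 : ℝ) ≤ 1 := by exact_mod_cast alpha_le_one
    linarith
  have hm : ∀ i j, Measurable fun G : Matrix p q 𝕜 => ENNReal.ofReal (‖(D * G * C) i j‖ ^ 2) :=
    fun i j => ((measurable_matrix_iff.1 ((measurable_const.matrix_mul measurable_id).matrix_mul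
      measurable_const) i j).norm.pow_const 2).ennreal_ofReal
  have hent : ∀ i j, ∫⁻ G, ENNReal.ofReal (‖(D * G * C) i j‖ ^ 2) ∂stdNormalMatrix 𝕜 p q =
      ENNReal.ofReal ((2 - alpha 𝕜) * ((∑ a, ‖D i a‖ ^ 2) * ∑ b, ‖C b j‖ ^ 2)) := fun i j => by
    have h := lintegral_norm_sq_trace_mul (Matrix.of fun a b => star (D i a) * star (C b j))
    rw [frobenius_norm_sq] at h
    simp only [Matrix.of_apply, norm_mul, norm_star, mul_pow, ← Finset.mul_sum,
      ← Finset.sum_mul] at h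
    rw [← h]
    refine lintegral_congr fun G => ?_
    congr 3
    simp only [Matrix.trace, Matrix.diag_apply, Matrix.mul_apply, Matrix.conjTranspose_apply,
      Matrix.of_apply, star_mul', star_star, Finset.sum_mul]
    exact Finset.sum_congr rfl fun b _ => Finset.sum_congr rfl fun a _ => by ring
  have hsum : ∀ M : Matrix p' q' 𝕜, ENNReal.ofReal (‖M‖ ^ 2) =
      ∑ x : p' × q', ENNReal.ofReal (‖M x.1 x.2‖ ^ 2) := fun M => by
    rw [frobenius_norm_sq, ← Fintype.sum_prod_type' (f := fun i j => ‖M i j‖ ^ 2),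
      ENNReal.ofReal_sum_of_nonneg fun _ _ => by positivity]
  rw [lintegral_congr fun G => hsum (D * G * C), lintegral_finsetSum _ fun x _ => hm x.1 x.2,
    Finset.sum_congr rfl fun x _ => hent x.1 x.2,
    ← ENNReal.ofReal_sum_of_nonneg fun _ _ => by positivity]
  congr 1
  rw [frobenius_norm_sq D, frobenius_norm_sq C, Finset.sum_comm (f := fun i j => ‖C i j‖ ^ 2),
    ← Finset.mul_sum, mul_assoc, Finset.sum_mul_sum, Fintype.sum_prod_type]

/-- Writes 1/x as a mixture of exponentials, so that inverse moments reduce to Laplace transforms by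
Tonelli. At x = 0 both sides are ∞. -/
theorem inv_ofReal_eq_lintegral_exp {x : ℝ} (hx : 0 ≤ x) :
    (ENNReal.ofReal x)⁻¹ =
      ∫⁻ u in Set.Ioi (0 : ℝ), ENNReal.ofReal (Real.exp (-(u / 2) * x) / 2) := by
  rcases hx.eq_or_lt with rfl | hx
  · simp
  · have hd : ∀ u ∈ Set.Ici (0 : ℝ), HasDerivAt (fun u : ℝ => -(x⁻¹ * Real.exp (-(u / 2) * x)))
        (Real.exp (-(u / 2) * x) / 2) u := fun u _ => by
      have h := ((((hasDerivAt_id u).div_const 2).neg.mul_const x).exp.const_mul x⁻¹).neg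
      refine h.congr_deriv ?_
      simp only [id, Pi.neg_apply]
      field_simp
    have ht : Filter.Tendsto (fun u : ℝ => -(x⁻¹ * Real.exp (-(u / 2) * x))) Filter.atTop
        (nhds (-(x⁻¹ * 0))) := by
      refine (Filter.Tendsto.const_mul _ (Real.tendsto_exp_atBot.comp ?_)).neg
      have : (fun u : ℝ => -(u / 2) * x) = fun u => -(x / 2) * u := by funext u; ring
      rw [this]
      exact Filter.tendsto_id.const_mul_atTop_of_neg (by linarith)
    have hpos : ∀ u ∈ Set.Ioi (0 : ℝ), 0 ≤ Real.exp (-(u / 2) * x) / 2 := fun u _ => by positivity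
    rw [← ofReal_integral_eq_lintegral_ofReal
      (integrableOn_Ioi_deriv_of_nonneg' hd hpos ht)
      (ae_of_all _ fun u => by simp only [Pi.zero_apply]; positivity),
      integral_Ioi_of_hasDerivAt_of_nonneg' hd hpos ht, ← ENNReal.ofReal_inv_of_pos hx]
    simp

theorem lintegral_one_add_rpow {N : ℝ} (hN : 2 < N) :
    ∫⁻ u in Set.Ioi (0 : ℝ), ENNReal.ofReal ((1 + u) ^ (-(N / 2)) / 2) =
      ENNReal.ofReal (1 / (N - 2)) := by
  have hd : ∀ u ∈ Set.Ici (0 : ℝ), HasDerivAt (fun u : ℝ => -((1 / (N - 2)) *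
      (1 + u) ^ (-((N - 2) / 2)))) ((1 + u) ^ (-(N / 2)) / 2) u := fun u hu => by
    have h := (((hasDerivAt_id u).const_add 1).rpow_const (p := -((N - 2) / 2))
      (Or.inl (by simp only [id]; have : (0 : ℝ) ≤ u := hu; positivity)) |>.const_mul
        (1 / (N - 2))).neg
    refine h.congr_deriv ?_
    have : N - 2 ≠ 0 := by linarith
    have e : -((N - 2) / 2) - 1 = -(N / 2) := by ring
    rw [e]
    simp only [id]
    field_simp
  have ht : Filter.Tendsto (fun u : ℝ => -((1 / (N - 2)) * (1 + u) ^ (-((N - 2) / 2))))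
      Filter.atTop (nhds (-((1 / (N - 2)) * 0))) := by
    refine (Filter.Tendsto.const_mul _ ?_).neg
    exact (tendsto_rpow_neg_atTop (by linarith)).comp (Filter.tendsto_atTop_add_const_left _ _
      Filter.tendsto_id)
  have hpos : ∀ u ∈ Set.Ioi (0 : ℝ), 0 ≤ (1 + u) ^ (-(N / 2)) / 2 := fun u hu => by
    have : (0 : ℝ) < u := hu
    positivity
  rw [← ofReal_integral_eq_lintegral_ofReal
    (integrableOn_Ioi_deriv_of_nonneg' hd hpos ht)
    ((ae_restrict_iff' measurableSet_Ioi).2 (ae_of_all _ hpos)),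
    integral_Ioi_of_hasDerivAt_of_nonneg' hd hpos ht]
  simp

theorem lintegral_inv_norm_sq
    (h : 2 < (Fintype.card p * Fintype.card q * (2 - alpha 𝕜) : ℝ)) :
    ∫⁻ G, (ENNReal.ofReal (‖G‖ ^ 2))⁻¹ ∂stdNormalMatrix 𝕜 p q =
      ENNReal.ofReal (1 / (Fintype.card p * Fintype.card q * (2 - alpha 𝕜) - 2)) := by
  have hn : Measurable fun G : Matrix p q 𝕜 => ‖G‖ ^ 2 :=
    (Measurable.frobenius_norm measurable_id).pow_const 2
  have hm : Measurable fun x : Matrix p q 𝕜 × ℝ =>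
      ENNReal.ofReal (Real.exp (-(x.2 / 2) * ‖x.1‖ ^ 2) / 2) :=
    ((((measurable_snd.div_const 2).neg.mul (hn.comp measurable_fst)).exp).div_const
      2).ennreal_ofReal
  simp_rw [fun G : Matrix p q 𝕜 => inv_ofReal_eq_lintegral_exp (sq_nonneg ‖G‖)]
  rw [lintegral_lintegral_swap hm.aemeasurable, ← lintegral_one_add_rpow h]
  refine setLIntegral_congr_fun measurableSet_Ioi fun u hu => ?_
  have hu' : (0 : ℝ) ≤ u := le_of_lt hu
  have hint : Integrable (fun G : Matrix p q 𝕜 => Real.exp (-(u / 2) * ‖G‖ ^ 2) / 2)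
      (stdNormalMatrix 𝕜 p q) := by
    refine Integrable.of_bound (C := 1) ((hn.const_mul _).exp.div_const 2).aestronglyMeasurable
      (ae_of_all _ fun G => ?_)
    have : Real.exp (-(u / 2) * ‖G‖ ^ 2) ≤ 1 := Real.exp_le_one_iff.2 (by
      have : 0 ≤ u / 2 * ‖G‖ ^ 2 := by positivity
      linarith)
    rw [Real.norm_of_nonneg (by positivity)]
    linarith [Real.exp_pos (-(u / 2) * ‖G‖ ^ 2)]
  rw [← ofReal_integral_eq_lintegral_ofReal hint (ae_of_all _ fun G => by
    simp only [Pi.zero_apply]; positivity), integral_div, integral_exp_norm_sq_stdNormalMatrix hu']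

end Moments

/-! ### Projections, coisometries and left inverses -/

section LinearAlgebra

variable {𝕜 : Type*} [RCLike 𝕜] {p q r : Type*} [Fintype p] [Fintype q] [Fintype r]

theorem norm_sq_mul_add_norm_sq_mul_one_sub [DecidableEq q] {E : Matrix q q 𝕜} (hE : Eᴴ = E)
    (hEE : E * E = E) (X : Matrix p q 𝕜) : ‖X * E‖ ^ 2 + ‖X * (1 - E)‖ ^ 2 = ‖X‖ ^ 2 := by
  have h1 := norm_sq_mul_conjTranspose X E
  have h2 := norm_sq_mul_conjTranspose X (1 - E)
  rw [Matrix.conjTranspose_sub, Matrix.conjTranspose_one, hE] at h2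
  rw [hE] at h1
  have h3 : (1 - E) * (1 - E) = 1 - E := by
    rw [Matrix.sub_mul, Matrix.mul_sub E, hEE]
    simp
  rw [h1, h2, h3, hEE, ← map_add, ← Matrix.trace_add, ← Matrix.mul_add, add_sub_cancel,
    Matrix.mul_one, frobenius_norm_sq_eq_trace]

theorem norm_mul_le_of_isProj {E : Matrix q q 𝕜} (hE : Eᴴ = E)
    (hEE : E * E = E) (X : Matrix p q 𝕜) : ‖X * E‖ ≤ ‖X‖ := by
  classical
  refine (sq_le_sq₀ (norm_nonneg _) (norm_nonneg _)).1 ?_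
  have := norm_sq_mul_add_norm_sq_mul_one_sub hE hEE X
  nlinarith [sq_nonneg ‖X * (1 - E)‖]

/-- The rows are conjugates of d orthonormal vectors in the orthogonal complement of the column span
of H, which is large enough by dimension count. -/
theorem exists_coisometry_mul_eq_zero (H : Matrix p q 𝕜) {d : ℕ}
    (hd : d + Fintype.card q ≤ Fintype.card p) :
    ∃ B : Matrix (Fin d) p 𝕜, B * Bᴴ = 1 ∧ B * H = 0 := by
  classical
  set W : Submodule 𝕜 (EuclideanSpace 𝕜 p) :=
    Submodule.span 𝕜 (Set.range fun j => WithLp.toLp 2 fun i => H i j) with hW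
  have hfin : Module.finrank 𝕜 W ≤ Fintype.card q := finrank_range_le_card _
  have hsum := W.finrank_add_finrank_orthogonal
  rw [finrank_euclideanSpace] at hsum
  have hle : d ≤ Module.finrank 𝕜 Wᗮ := by omega
  set b := stdOrthonormalBasis 𝕜 Wᗮ
  refine ⟨Matrix.of fun a i => star ((b (Fin.castLE hle a) : EuclideanSpace 𝕜 p) i), ?_, ?_⟩
  · ext a c
    have h := orthonormal_iff_ite.1 b.orthonormal (Fin.castLE hle a) (Fin.castLE hle c)
    rw [Submodule.coe_inner, PiLp.inner_apply] at h
    simp only [Matrix.mul_apply, Matrix.of_apply, Matrix.conjTranspose_apply, star_star,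
      Matrix.one_apply]
    simp only [RCLike.inner_apply, RCLike.star_def, (Fin.castLE_injective hle).eq_iff] at h ⊢
    rw [← h]
    exact Finset.sum_congr rfl fun i _ => mul_comm _ _
  · ext a j
    have h := Submodule.inner_left_of_mem_orthogonal (K := W)
      (u := WithLp.toLp 2 fun i => H i j) (Submodule.subset_span ⟨j, rfl⟩)
      (b (Fin.castLE hle a)).2
    rw [PiLp.inner_apply] at h
    simp only [Matrix.mul_apply, Matrix.of_apply, Matrix.zero_apply]
    rw [← h]
    exact Finset.sum_congr rfl fun i _ => by simp [RCLike.inner_apply, mul_comm]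

/-- The left inverse `(MᴴM)⁻¹Mᴴ` of a matrix with full column rank. -/
noncomputable def leftInv [DecidableEq q] (M : Matrix p q 𝕜) : Matrix q p 𝕜 := (Mᴴ * M)⁻¹ * Mᴴ

theorem measurable_leftInv [DecidableEq q] : Measurable (leftInv : Matrix p q 𝕜 → _) :=
  (measurable_matrix_inv.comp
    ((Measurable.matrix_conjTranspose measurable_id).matrix_mul measurable_id)).matrix_mul
    (Measurable.matrix_conjTranspose measurable_id)

theorem leftInv_mul_self [DecidableEq q] {M : Matrix p q 𝕜} (h : (Mᴴ * M).det ≠ 0) :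
    leftInv M * M = 1 := by
  rw [leftInv, Matrix.mul_assoc, Matrix.nonsing_inv_mul _ (isUnit_iff_ne_zero.2 h)]

theorem leftInv_eq_zero [DecidableEq q] {M : Matrix p q 𝕜} (h : (Mᴴ * M).det = 0) :
    leftInv M = 0 := by
  rw [leftInv, Matrix.nonsing_inv_apply_not_isUnit _ (by simp [h]), Matrix.zero_mul]

theorem conjTranspose_mul_leftInv [DecidableEq q] (M : Matrix p q 𝕜) :
    (M * leftInv M)ᴴ = M * leftInv M := by
  rw [leftInv, Matrix.conjTranspose_mul, Matrix.conjTranspose_mul,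
    Matrix.conjTranspose_conjTranspose, Matrix.conjTranspose_nonsing_inv, Matrix.conjTranspose_mul,
    Matrix.conjTranspose_conjTranspose, Matrix.mul_assoc]

theorem det_ne_zero_of_mul_eq_one [DecidableEq q] {M : Matrix p q 𝕜} {U : Matrix q p 𝕜}
    (h : U * M = 1) : (Mᴴ * M).det ≠ 0 := by
  intro h0
  obtain ⟨v, hv, hv0⟩ := Matrix.exists_mulVec_eq_zero_iff.2 h0
  open scoped ComplexOrder in
  rw [Matrix.conjTranspose_mul_self_mulVec_eq_zero] at hv0
  apply hv
  rw [← Matrix.one_mulVec v, ← h, ← Matrix.mulVec_mulVec, hv0, Matrix.mulVec_zero]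

/-- With full column rank, R M† = u(MM†) is u followed by an orthogonal projection, hence the
least-norm solution. Otherwise `leftInv M` is 0 by the convention for singular inverses, so no rank
hypothesis is needed. -/
theorem norm_mul_leftInv_le [DecidableEq q] {M : Matrix p q 𝕜} {R : Matrix r q 𝕜}
    {u : Matrix r p 𝕜} (hu : u * M = R) : ‖R * leftInv M‖ ≤ ‖u‖ := by
  by_cases h : (Mᴴ * M).det = 0
  · rw [leftInv_eq_zero h, Matrix.mul_zero, norm_zero]
    exact norm_nonneg _
  · rw [← hu, Matrix.mul_assoc]
    refine norm_mul_le_of_isProj (conjTranspose_mul_leftInv M) ?_ u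
    rw [Matrix.mul_assoc, ← Matrix.mul_assoc _ M, leftInv_mul_self h, Matrix.one_mul]

end LinearAlgebra

/-- A row which reproduces a column `g` outside of the kernel of `B` and annihilates the kernel. -/
theorem exists_row_mul_eq {𝕜 : Type*} [RCLike 𝕜] {p q : Type*} [Fintype p] {d : ℕ}
    {B : Matrix (Fin d) p 𝕜} (hB : B * Bᴴ = 1) {g : Matrix p Unit 𝕜} (hg : B * g ≠ 0) :
    ∃ u : Matrix Unit p 𝕜, u * g = 1 ∧ (∀ H : Matrix p q 𝕜, B * H = 0 → u * H = 0) ∧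
      ‖u‖ ^ 2 = (‖B * g‖ ^ 2)⁻¹ := by
  have hn : ‖B * g‖ ≠ 0 := norm_ne_zero_iff.2 hg
  have h1 : (B * g)ᴴ * (B * g) = ((‖B * g‖ ^ 2 : ℝ) : 𝕜) • (1 : Matrix Unit Unit 𝕜) := by
    ext i j
    simp only [Matrix.smul_apply, Matrix.one_apply_eq, smul_eq_mul, mul_one]
    rw [frobenius_norm_sq, Matrix.mul_apply]
    push_cast
    refine Finset.sum_congr rfl fun a _ => ?_
    simp [RCLike.conj_mul]
  have h2 : ∀ c : ℝ, ∀ Y : Matrix Unit p 𝕜, ‖(c : 𝕜) • Y‖ ^ 2 = c ^ 2 * ‖Y‖ ^ 2 := fun c Y => by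
    rw [frobenius_norm_sq, frobenius_norm_sq, Finset.mul_sum]
    simp [mul_pow, Finset.mul_sum]
  -- The dual vector of g within the row space of B.
  refine ⟨(((‖B * g‖ ^ 2)⁻¹ : ℝ) : 𝕜) • ((B * g)ᴴ * B), ?_, fun H hH => ?_, ?_⟩
  · rw [Matrix.smul_mul, Matrix.mul_assoc, h1, smul_smul, ← RCLike.ofReal_mul,
      inv_mul_cancel₀ (pow_ne_zero _ hn)]
    simp
  · rw [Matrix.smul_mul, Matrix.mul_assoc, hH, Matrix.mul_zero, smul_zero]
  · have h3 : ‖(B * g)ᴴ * B‖ ^ 2 = ‖B * g‖ ^ 2 := by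
      have := norm_sq_mul_conjTranspose ((B * g)ᴴ) Bᴴ
      rw [Matrix.conjTranspose_conjTranspose, hB, Matrix.mul_one, Matrix.trace_mul_comm,
        Matrix.conjTranspose_conjTranspose] at this
      rw [this, ← frobenius_norm_sq_eq_trace]
    rw [h2, h3]
    field_simp

/-- Supplies the complementary coordinate projections that separate one column of a Gaussian matrix
from the others. -/
theorem conjTranspose_mul_self_add_eq_one {𝕜 : Type*} [RCLike 𝕜] {q r : Type*} [Fintype q]
    [Fintype r] [DecidableEq q] {f : r → q} {i₀ : q}
    (hf : Function.Bijective (Sum.elim f fun _ : Unit => i₀)) :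
    ((1 : Matrix q q 𝕜).submatrix f id)ᴴ * (1 : Matrix q q 𝕜).submatrix f id +
      ((1 : Matrix q q 𝕜).submatrix (fun _ : Unit => i₀) id)ᴴ *
        (1 : Matrix q q 𝕜).submatrix (fun _ : Unit => i₀) id = 1 := by
  ext i j
  have h := (Equiv.ofBijective _ hf).sum_comp
    fun b => star ((1 : Matrix q q 𝕜) b i) * (1 : Matrix q q 𝕜) b j
  rw [Fintype.sum_sum_type] at h
  have h1 : ∑ b, star ((1 : Matrix q q 𝕜) b i) * (1 : Matrix q q 𝕜) b j =
      (1 : Matrix q q 𝕜) i j := by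
    have := congrFun (congrFun (Matrix.one_mul (1 : Matrix q q 𝕜)) i) j
    nth_rw 1 [← Matrix.conjTranspose_one] at this
    rwa [Matrix.mul_apply] at this
  rw [← h1, ← h]
  rfl


/-! ### Full rank almost surely, and the norm of the pseudoinverse -/

section Rank

variable {𝕜 : Type*} [RCLike 𝕜] {p q : Type*} [Fintype p] [Fintype q]

theorem lintegral_inv_norm_sq_mul {d : ℕ} {B : Matrix (Fin d) p 𝕜} (hB : B * Bᴴ = 1)
    (hd : 2 < (d * (2 - alpha 𝕜) : ℝ)) :
    ∫⁻ g, (ENNReal.ofReal (‖B * g‖ ^ 2))⁻¹ ∂stdNormalMatrix 𝕜 p Unit =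
      ENNReal.ofReal (1 / (d * (2 - alpha 𝕜) - 2)) := by
  have h := lintegral_inv_norm_sq (𝕜 := 𝕜) (p := Fin d) (q := Unit) (by simpa using hd)
  have hB' : Measurable fun g : Matrix p Unit 𝕜 => B * g :=
    Measurable.matrix_mul measurable_const measurable_id
  rw [← map_mul_left_stdNormalMatrix hB, lintegral_map
    (f := fun G : Matrix (Fin d) Unit 𝕜 => (ENNReal.ofReal (‖G‖ ^ 2))⁻¹)
    ((Measurable.frobenius_norm measurable_id).pow_const 2).ennreal_ofReal.inv hB'] at h
  simpa using h

/-- A finite inverse moment excludes the value 0, whose inverse is ∞. -/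
theorem ae_mul_ne_zero {d : ℕ} {B : Matrix (Fin d) p 𝕜} (hB : B * Bᴴ = 1)
    (hd : 2 < (d * (2 - alpha 𝕜) : ℝ)) :
    ∀ᵐ (g : Matrix p Unit 𝕜) ∂stdNormalMatrix 𝕜 p Unit, B * g ≠ 0 := by
  have h := lintegral_inv_norm_sq_mul hB hd
  have hm : Measurable fun g : Matrix p Unit 𝕜 => (ENNReal.ofReal (‖B * g‖ ^ 2))⁻¹ :=
    ((Measurable.matrix_mul measurable_const
      measurable_id).frobenius_norm.pow_const 2).ennreal_ofReal.inv
  filter_upwards [ae_lt_top hm (h ▸ ENNReal.ofReal_ne_top)] with g hg h0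
  simp [h0] at hg

theorem two_lt_mul_two_sub_alpha {d : ℕ} (hd : alpha 𝕜 + 1 < d) :
    2 < (d * (2 - alpha 𝕜) : ℝ) := by
  have h1 := alpha_le_one (𝕜 := 𝕜)
  have h2 : ((alpha 𝕜 : ℝ) + 2) ≤ d := by exact_mod_cast hd
  interval_cases alpha 𝕜 <;> norm_num at h2 ⊢ <;> linarith

theorem measurableSet_det_ne_zero [DecidableEq q] :
    MeasurableSet {G : Matrix p q 𝕜 | (Gᴴ * G).det ≠ 0} :=
  (measurable_matrix_det.comp
    ((Measurable.matrix_conjTranspose measurable_id).matrix_mul measurable_id))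
    (measurableSet_singleton 0).compl

theorem ae_det_ne_zero {t s : ℕ} (hs : s + alpha 𝕜 < t) :
    ∀ᵐ G ∂stdNormalMatrix 𝕜 (Fin t) (Fin s), (Gᴴ * G).det ≠ 0 := by
  induction s with
  | zero => simp
  | succ s ih =>
    specialize ih (by omega)
    set P₁ : Matrix Unit (Fin (s + 1)) 𝕜 :=
      (1 : Matrix (Fin (s + 1)) _ 𝕜).submatrix (fun _ => 0) id
    set P₂ : Matrix (Fin s) (Fin (s + 1)) 𝕜 := (1 : Matrix _ _ 𝕜).submatrix Fin.succ id
    have hP : P₂ᴴ * P₂ + P₁ᴴ * P₁ = 1 := by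
      refine conjTranspose_mul_self_add_eq_one ⟨?_, fun b => ?_⟩
      · rintro (a | a) (b | b) hab
        · exact congrArg _ (Fin.succ_injective _ hab)
        · exact absurd hab (Fin.succ_ne_zero a)
        · exact absurd hab.symm (Fin.succ_ne_zero b)
        · rfl
      · refine Fin.cases ⟨Sum.inr (), rfl⟩ (fun a => ⟨Sum.inl a, rfl⟩) b
    rw [← map_mul_add_mul_stdNormalMatrix hP]
    have hT : Measurable fun x : Matrix (Fin t) (Fin s) 𝕜 × Matrix (Fin t) Unit 𝕜 =>
        x.1 * P₂ + x.2 * P₁ :=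
      (measurable_fst.matrix_mul measurable_const).matrix_add
        (measurable_snd.matrix_mul measurable_const)
    rw [ae_map_iff hT.aemeasurable measurableSet_det_ne_zero]
    refine (Measure.ae_prod_iff_ae_ae (p := fun x : Matrix (Fin t) (Fin s) 𝕜 ×
      Matrix (Fin t) Unit 𝕜 => ((x.1 * P₂ + x.2 * P₁)ᴴ * (x.1 * P₂ + x.2 * P₁)).det ≠ 0)
      (hT measurableSet_det_ne_zero)).2 ?_
    filter_upwards [ih] with H hH
    obtain ⟨B, hB, hBH⟩ := exists_coisometry_mul_eq_zero H (d := t - s)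
      (by simp only [Fintype.card_fin]; omega)
    filter_upwards [ae_mul_ne_zero hB (two_lt_mul_two_sub_alpha (𝕜 := 𝕜) (by omega))] with g hg
    obtain ⟨u, hug, huH, -⟩ := exists_row_mul_eq (q := Fin s) hB hg
    have hK := leftInv_mul_self hH
    -- An explicit left inverse of [g H]: u reads off the coefficient of g, and H† reads off those
    -- of H once the contribution of g is subtracted.
    refine det_ne_zero_of_mul_eq_one (U := P₁ᴴ * u + P₂ᴴ * (leftInv H - leftInv H * g * u)) ?_
    have e1 : u * (H * P₂ + g * P₁) = P₁ := by
      rw [Matrix.mul_add, ← Matrix.mul_assoc, ← Matrix.mul_assoc, hug, huH H hBH]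
      simp
    have e2 : leftInv H * (H * P₂ + g * P₁) = P₂ + leftInv H * g * P₁ := by
      rw [Matrix.mul_add, ← Matrix.mul_assoc, ← Matrix.mul_assoc, hK, Matrix.one_mul]
    rw [Matrix.add_mul, Matrix.mul_assoc, e1, Matrix.mul_assoc, Matrix.sub_mul, e2,
      Matrix.mul_assoc (leftInv H * g), e1, add_sub_cancel_right, add_comm (P₁ᴴ * P₁), hP]

theorem lintegral_norm_sq_leftInv_le {t s : ℕ} (hs : s + alpha 𝕜 < t) :
    ∫⁻ G, ENNReal.ofReal (‖leftInv G‖ ^ 2) ∂stdNormalMatrix 𝕜 (Fin t) (Fin s) ≤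
      ENNReal.ofReal (ratio 𝕜 s t / (2 - alpha 𝕜)) := by
  have hrow : ∀ i : Fin s, ∫⁻ G, ENNReal.ofReal (‖(1 : Matrix (Fin s) (Fin s) 𝕜).submatrix
      (fun _ : Unit => i) id * leftInv G‖ ^ 2) ∂stdNormalMatrix 𝕜 (Fin t) (Fin s) ≤
      ENNReal.ofReal (1 / ((t - s + 1 : ℕ) * (2 - alpha 𝕜) - 2)) := fun i => by
    set P₁ : Matrix Unit (Fin s) 𝕜 := (1 : Matrix _ _ 𝕜).submatrix (fun _ => i) id
    set P₂ : Matrix {j // j ≠ i} (Fin s) 𝕜 := (1 : Matrix _ _ 𝕜).submatrix Subtype.val id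
    have hP : P₂ᴴ * P₂ + P₁ᴴ * P₁ = 1 := by
      refine conjTranspose_mul_self_add_eq_one ⟨?_, fun b => ?_⟩
      · rintro (a | a) (b | b) hab
        · exact congrArg _ (Subtype.ext hab)
        · exact absurd hab a.2
        · exact absurd hab.symm b.2
        · rfl
      · by_cases h : b = i
        · exact ⟨Sum.inr (), h.symm⟩
        · exact ⟨Sum.inl ⟨b, h⟩, rfl⟩
    rw [← map_mul_add_mul_stdNormalMatrix hP]
    have hT : Measurable fun x : Matrix (Fin t) {j // j ≠ i} 𝕜 × Matrix (Fin t) Unit 𝕜 =>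
        x.1 * P₂ + x.2 * P₁ :=
      (measurable_fst.matrix_mul measurable_const).matrix_add
        (measurable_snd.matrix_mul measurable_const)
    have hF : Measurable fun G : Matrix (Fin t) (Fin s) 𝕜 =>
        ENNReal.ofReal (‖P₁ * leftInv G‖ ^ 2) :=
      ((measurable_const.matrix_mul measurable_leftInv).frobenius_norm.pow_const 2).ennreal_ofReal
    rw [lintegral_map hF hT, lintegral_prod (fun x : Matrix (Fin t) {j // j ≠ i} 𝕜 ×
      Matrix (Fin t) Unit 𝕜 => ENNReal.ofReal (‖P₁ * leftInv (x.1 * P₂ + x.2 * P₁)‖ ^ 2))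
      (hF.comp hT).aemeasurable]
    have hbound : ∀ H : Matrix (Fin t) {j // j ≠ i} 𝕜,
        ∫⁻ g, ENNReal.ofReal (‖P₁ * leftInv (H * P₂ + g * P₁)‖ ^ 2)
          ∂stdNormalMatrix 𝕜 (Fin t) Unit ≤
        ENNReal.ofReal (1 / ((t - s + 1 : ℕ) * (2 - alpha 𝕜) - 2)) := fun H => by
      have hs0 : 0 < s := i.pos
      -- Only s - 1 columns remain in H, hence t - s + 1 free dimensions.
      obtain ⟨B, hB, hBH⟩ := exists_coisometry_mul_eq_zero H (d := t - s + 1) (by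
        simp only [Fintype.card_subtype_compl, Fintype.card_fin, Fintype.card_unique, ne_eq]
        omega)
      rw [← lintegral_inv_norm_sq_mul hB (two_lt_mul_two_sub_alpha (by omega))]
      refine lintegral_mono fun g => ?_
      by_cases hg : B * g = 0
      · simp [hg]
      · obtain ⟨u, hug, huH, hu⟩ := exists_row_mul_eq (q := {j // j ≠ i}) hB hg
        have e1 : u * (H * P₂ + g * P₁) = P₁ := by
          rw [Matrix.mul_add, ← Matrix.mul_assoc, ← Matrix.mul_assoc, hug, huH H hBH]
          simp
        have := norm_ne_zero_iff.2 hg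
        simp only
        rw [← ENNReal.ofReal_inv_of_pos (by positivity), ← hu]
        exact ENNReal.ofReal_le_ofReal
          (pow_le_pow_left₀ (norm_nonneg _) (norm_mul_leftInv_le e1) 2)
    refine (lintegral_mono hbound).trans ?_
    simp
  have hsum : ∀ G : Matrix (Fin t) (Fin s) 𝕜, ENNReal.ofReal (‖leftInv G‖ ^ 2) =
      ∑ i, ENNReal.ofReal (‖(1 : Matrix (Fin s) (Fin s) 𝕜).submatrix
        (fun _ : Unit => i) id * leftInv G‖ ^ 2) := fun G => by
    rw [← ENNReal.ofReal_sum_of_nonneg fun _ _ => by positivity, frobenius_norm_sq]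
    congr 1
    refine Finset.sum_congr rfl fun i _ => ?_
    rw [frobenius_norm_sq]
    simp [Matrix.mul_apply, Matrix.one_apply]
  rw [lintegral_congr hsum, lintegral_finsetSum _ fun i _ =>
    ((measurable_const.matrix_mul measurable_leftInv).frobenius_norm.pow_const 2).ennreal_ofReal]
  refine (Finset.sum_le_sum fun i _ => hrow i).trans ?_
  have hα := alpha_le_one (𝕜 := 𝕜)
  have hst : (s : ℝ) + alpha 𝕜 < t := by exact_mod_cast hs
  rw [Finset.sum_const, Finset.card_univ, Fintype.card_fin, nsmul_eq_mul,
    ← ENNReal.ofReal_natCast, ← ENNReal.ofReal_mul (by positivity)]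
  -- The denominator (t - s + 1)(2 - α) - 2 equals t - s - 1 over ℝ and 2(t - s) over ℂ, that is, (2
  -- - α)(t - s - α).
  refine ENNReal.ofReal_le_ofReal (le_of_eq ?_)
  rw [ratio, Nat.cast_add, Nat.cast_sub (by omega)]
  interval_cases alpha 𝕜
  · have h : (t : ℝ) - s ≠ 0 := by push_cast at hst; linarith
    have e : ((t : ℝ) - s + (1 : ℕ)) * (2 - (0 : ℕ)) - 2 = (t - s) * 2 := by push_cast; ring
    rw [e]
    push_cast
    rw [sub_zero, sub_zero]
    field_simp
  · norm_num
    rw [div_eq_mul_inv]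
    congr 2
    ring

variable {s : Type*} [Fintype s] [DecidableEq p] [DecidableEq s]

/-- Resamples a Gaussian G from independent pieces along the range of V and its complement; the
first piece is exactly GV. -/
theorem map_mul_conjTranspose_add_stdNormalMatrix {t : Type*} [Fintype t] {V : Matrix p s 𝕜}
    (hV : Vᴴ * V = 1) :
    ((stdNormalMatrix 𝕜 t s).prod (stdNormalMatrix 𝕜 t p)).map
      (fun x => x.1 * Vᴴ + x.2 * (1 - V * Vᴴ)) = stdNormalMatrix 𝕜 t p := by
  refine map_mul_add_mul_stdNormalMatrix ?_
  have h : V * Vᴴ * (V * Vᴴ) = V * Vᴴ := by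
    rw [Matrix.mul_assoc, ← Matrix.mul_assoc _ V, hV, Matrix.one_mul]
  rw [Matrix.conjTranspose_sub, Matrix.conjTranspose_one, Matrix.conjTranspose_mul,
    Matrix.conjTranspose_conjTranspose, Matrix.sub_mul, Matrix.mul_sub (V * Vᴴ), h]
  simp

theorem mul_conjTranspose_add_mul_self {t : Type*} {V : Matrix p s 𝕜} (hV : Vᴴ * V = 1)
    (G₁ : Matrix t s 𝕜) (G₂ : Matrix t p 𝕜) : (G₁ * Vᴴ + G₂ * (1 - V * Vᴴ)) * V = G₁ := by
  rw [Matrix.add_mul, Matrix.mul_assoc, hV, Matrix.mul_assoc, Matrix.sub_mul, Matrix.mul_assoc, hV]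
  simp

end Rank

/-! ### Gaussian least squares -/

section LeastSquares

variable {𝕜 : Type*} [RCLike 𝕜] {p q : Type*} [Fintype p] [Fintype q] [DecidableEq p]

/-- The expected excess error of a Gaussian least-squares problem. -/
theorem lintegral_norm_sq_leftInv_mul_le {t s : ℕ}
    (hs : s + alpha 𝕜 < t) {V : Matrix p (Fin s) 𝕜} (hV : Vᴴ * V = 1) {C : Matrix p q 𝕜}
    (hC : Vᴴ * C = 0) :
    ∫⁻ G, ENNReal.ofReal (‖leftInv (G * V) * (G * C)‖ ^ 2) ∂stdNormalMatrix 𝕜 (Fin t) p ≤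
      ENNReal.ofReal (ratio 𝕜 s t * ‖C‖ ^ 2) := by
  have hα : (0 : ℝ) < 2 - alpha 𝕜 := by
    have : (alpha 𝕜 : ℝ) ≤ 1 := by exact_mod_cast alpha_le_one
    linarith
  have hT : Measurable fun x : Matrix (Fin t) (Fin s) 𝕜 × Matrix (Fin t) p 𝕜 =>
      x.1 * Vᴴ + x.2 * (1 - V * Vᴴ) :=
    (measurable_fst.matrix_mul measurable_const).matrix_add
      (measurable_snd.matrix_mul measurable_const)
  have hF : Measurable fun G : Matrix (Fin t) p 𝕜 =>
      ENNReal.ofReal (‖leftInv (G * V) * (G * C)‖ ^ 2) :=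
    (((measurable_leftInv.comp (measurable_id.matrix_mul measurable_const)).matrix_mul
      (measurable_id.matrix_mul measurable_const)).frobenius_norm.pow_const 2).ennreal_ofReal
  have hL : Measurable fun G : Matrix (Fin t) (Fin s) 𝕜 => ENNReal.ofReal (‖leftInv G‖ ^ 2) :=
    (measurable_leftInv.frobenius_norm.pow_const 2).ennreal_ofReal
  have hC' : ∀ (G₁ : Matrix (Fin t) (Fin s) 𝕜) (G₂ : Matrix (Fin t) p 𝕜),
      (G₁ * Vᴴ + G₂ * (1 - V * Vᴴ)) * C = G₂ * C := fun G₁ G₂ => by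
    rw [Matrix.add_mul, Matrix.mul_assoc, hC, Matrix.mul_assoc G₂, Matrix.sub_mul,
      Matrix.mul_assoc, hC]
    simp
  rw [← map_mul_conjTranspose_add_stdNormalMatrix hV, lintegral_map hF hT,
    lintegral_prod (fun x : Matrix (Fin t) (Fin s) 𝕜 × Matrix (Fin t) p 𝕜 =>
      ENNReal.ofReal (‖leftInv ((x.1 * Vᴴ + x.2 * (1 - V * Vᴴ)) * V) *
        ((x.1 * Vᴴ + x.2 * (1 - V * Vᴴ)) * C)‖ ^ 2)) (hF.comp hT).aemeasurable]
  -- The pseudoinverse sees only the first piece and GC only the second, so the inner integral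
  -- treats `leftInv` as a constant.
  simp_rw [mul_conjTranspose_add_mul_self hV, hC', ← Matrix.mul_assoc,
    lintegral_norm_sq_mul_mul]
  have hsplit : ∀ x : ℝ, 0 ≤ x → ENNReal.ofReal ((2 - alpha 𝕜) * x * ‖C‖ ^ 2) =
      ENNReal.ofReal ((2 - alpha 𝕜) * ‖C‖ ^ 2) * ENNReal.ofReal x := fun x hx => by
    rw [← ENNReal.ofReal_mul (by positivity)]
    congr 1
    ring
  rw [lintegral_congr fun G => hsplit (‖leftInv G‖ ^ 2) (sq_nonneg _), lintegral_const_mul _ hL]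
  refine (mul_le_mul_right (lintegral_norm_sq_leftInv_le hs) _).trans (le_of_eq ?_)
  rw [← ENNReal.ofReal_mul (by positivity)]
  congr 1
  field_simp

theorem ae_det_mul_ne_zero {t s : ℕ}
    (hs : s + alpha 𝕜 < t) {V : Matrix p (Fin s) 𝕜} (hV : Vᴴ * V = 1) :
    ∀ᵐ G ∂stdNormalMatrix 𝕜 (Fin t) p, ((G * V)ᴴ * (G * V)).det ≠ 0 := by
  have hT : Measurable fun x : Matrix (Fin t) (Fin s) 𝕜 × Matrix (Fin t) p 𝕜 =>
      x.1 * Vᴴ + x.2 * (1 - V * Vᴴ) :=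
    (measurable_fst.matrix_mul measurable_const).matrix_add
      (measurable_snd.matrix_mul measurable_const)
  have hm : MeasurableSet {G : Matrix (Fin t) p 𝕜 | ((G * V)ᴴ * (G * V)).det ≠ 0} :=
    (measurable_id.matrix_mul measurable_const) measurableSet_det_ne_zero
  rw [← map_mul_conjTranspose_add_stdNormalMatrix hV, ae_map_iff hT.aemeasurable hm]
  simp_rw [mul_conjTranspose_add_mul_self hV]
  exact Measure.quasiMeasurePreserving_fst.ae (ae_det_ne_zero hs)

end LeastSquares

/-! ### Orthogonal residuals and factorization through an isometry -/

section Isometry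

variable {𝕜 : Type*} [RCLike 𝕜] {p q s : Type*} [Fintype p] [Fintype q] [Fintype s]
  [DecidableEq s]

theorem norm_sq_sub_mul_of_orthogonal {V : Matrix p s 𝕜} (hV : Vᴴ * V = 1) {C : Matrix p q 𝕜}
    (hC : Vᴴ * C = 0) (D : Matrix s q 𝕜) : ‖C - V * D‖ ^ 2 = ‖C‖ ^ 2 + ‖D‖ ^ 2 := by
  have hC' : Cᴴ * V = 0 := by
    rw [← Matrix.conjTranspose_conjTranspose V, ← Matrix.conjTranspose_mul, hC,
      Matrix.conjTranspose_zero]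
  have h1 : (C - V * D)ᴴ * (C - V * D) = Cᴴ * C + Dᴴ * D := by
    rw [Matrix.conjTranspose_sub, Matrix.conjTranspose_mul, Matrix.sub_mul, Matrix.mul_sub,
      Matrix.mul_sub, ← Matrix.mul_assoc, hC', Matrix.mul_assoc, hC, Matrix.mul_assoc Dᴴ,
      ← Matrix.mul_assoc Vᴴ, hV]
    simp
  rw [frobenius_norm_sq_eq_trace, h1, Matrix.trace_add, map_add, ← frobenius_norm_sq_eq_trace,
    ← frobenius_norm_sq_eq_trace]

theorem conjTranspose_mul_residual {q : Type*} {V : Matrix p s 𝕜} (hV : Vᴴ * V = 1)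
    (M : Matrix p q 𝕜) :
    Vᴴ * (M - V * (Vᴴ * M)) = 0 := by
  rw [Matrix.mul_sub, ← Matrix.mul_assoc, hV, Matrix.one_mul, sub_self]

theorem norm_sq_sub_isometry_mul {V : Matrix p s 𝕜} (hV : Vᴴ * V = 1) (M : Matrix p q 𝕜)
    (Z : Matrix s q 𝕜) :
    ‖M - V * Z‖ ^ 2 = ‖M - V * (Vᴴ * M)‖ ^ 2 + ‖Z - Vᴴ * M‖ ^ 2 := by
  rw [← norm_sq_sub_mul_of_orthogonal hV (conjTranspose_mul_residual hV M), Matrix.mul_sub]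
  congr 2
  abel

theorem norm_residual_le {V : Matrix p s 𝕜} (hV : Vᴴ * V = 1) (M : Matrix p q 𝕜)
    (Z : Matrix s q 𝕜) : ‖M - V * (Vᴴ * M)‖ ≤ ‖M - V * Z‖ := by
  refine (sq_le_sq₀ (norm_nonneg _) (norm_nonneg _)).1 ?_
  rw [norm_sq_sub_isometry_mul hV M Z]
  exact le_add_of_nonneg_right (sq_nonneg _)

theorem norm_sub_conjTranspose_mul_le {V : Matrix p s 𝕜} (hV : Vᴴ * V = 1) (M : Matrix p q 𝕜)
    (Z : Matrix s q 𝕜) : ‖Z - Vᴴ * M‖ ≤ ‖M - V * Z‖ := by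
  refine (sq_le_sq₀ (norm_nonneg _) (norm_nonneg _)).1 ?_
  rw [norm_sq_sub_isometry_mul hV M Z]
  exact le_add_of_nonneg_left (sq_nonneg _)

theorem norm_isometry_mul {V : Matrix p s 𝕜} (hV : Vᴴ * V = 1) (Z : Matrix s q 𝕜) :
    ‖V * Z‖ = ‖Z‖ := by
  have h := norm_sq_sub_isometry_mul hV (0 : Matrix p q 𝕜) Z
  simp only [Matrix.mul_zero, sub_zero, zero_sub, norm_neg, norm_zero] at h
  refine (sq_eq_sq₀ (norm_nonneg _) (norm_nonneg _)).1 ?_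
  rw [h]
  simp

/-- V is an orthonormal basis of the column space and Z holds the coordinates of the columns. -/
theorem exists_isometry_mul_eq (M : Matrix p q 𝕜) :
    ∃ (d : ℕ) (V : Matrix p (Fin d) 𝕜) (Z : Matrix (Fin d) q 𝕜),
      d ≤ M.rank ∧ Vᴴ * V = 1 ∧ M = V * Z := by
  classical
  set W : Submodule 𝕜 (EuclideanSpace 𝕜 p) :=
    (Submodule.span 𝕜 (Set.range M.col)).map
      (WithLp.linearEquiv 2 𝕜 (p → 𝕜)).symm.toLinearMap with hW
  have hfin : Module.finrank 𝕜 W = M.rank := by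
    rw [Matrix.rank_eq_finrank_span_cols, hW]
    exact LinearEquiv.finrank_map_eq _ _
  set b := stdOrthonormalBasis 𝕜 W
  have hmem : ∀ j, WithLp.toLp 2 (fun i => M i j) ∈ W := fun j =>
    ⟨M.col j, Submodule.subset_span ⟨j, rfl⟩, rfl⟩
  refine ⟨_, Matrix.of fun i a => (b a : EuclideanSpace 𝕜 p) i,
    Matrix.of fun a j => b.repr ⟨_, hmem j⟩ a, hfin.le, ?_, ?_⟩
  · ext a c
    have h := orthonormal_iff_ite.1 b.orthonormal a c
    rw [Submodule.coe_inner, PiLp.inner_apply] at h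
    simp only [Matrix.mul_apply, Matrix.of_apply, Matrix.conjTranspose_apply,
      Matrix.one_apply]
    rw [← h]
    exact Finset.sum_congr rfl fun i _ => by simp [RCLike.inner_apply, mul_comm]
  · ext i j
    have h := congrArg (fun w : W => (w : EuclideanSpace 𝕜 p) i) (b.sum_repr ⟨_, hmem j⟩)
    simp only [Submodule.coe_sum, Submodule.coe_smul] at h
    rw [Matrix.mul_apply]
    refine Eq.trans h.symm ?_
    simp only [WithLp.ofLp_sum, Finset.sum_apply, PiLp.smul_apply, smul_eq_mul]
    exact Finset.sum_congr rfl fun a _ => mul_comm _ _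

end Isometry

/-! ### Expected errors of the two sketching stages -/

section Expectation

variable {𝕜 : Type*} [RCLike 𝕜]

theorem ratio_nonneg {s t : ℕ} (hs : s + alpha 𝕜 < t) : 0 ≤ ratio 𝕜 s t := by
  have : (s : ℝ) + alpha 𝕜 < t := by exact_mod_cast hs
  exact div_nonneg (by positivity) (by linarith)

theorem ratio_mono {s s' t : ℕ} (hss' : s ≤ s') (hs : s' + alpha 𝕜 < t) :
    ratio 𝕜 s t ≤ ratio 𝕜 s' t := by
  have h1 : (s' : ℝ) + alpha 𝕜 < t := by exact_mod_cast hs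
  have h2 : (s : ℝ) ≤ s' := by exact_mod_cast hss'
  exact div_le_div₀ (by positivity) h2 (by linarith) (by linarith)

/-- Trades the pseudoinverse, obtained by choice, for a formula that is measurable by inspection. -/
theorem pinv_eq_leftInv {m n : ℕ} {M : Matrix (Fin m) (Fin n) 𝕜} (h : (Mᴴ * M).det ≠ 0) :
    pinv M = leftInv M := by
  have h1 := leftInv_mul_self h
  refine (pinv_spec M).unique ⟨?_, ?_, conjTranspose_mul_leftInv M, ?_⟩
  · rw [Matrix.mul_assoc, h1, Matrix.mul_one]
  · rw [h1, Matrix.one_mul]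
  · rw [h1, Matrix.conjTranspose_one]

/-- When GV has full rank, the least-squares solution is VᴴM + (GV)†GC with C the residual. The two
error terms C and V(GV)†GC are orthogonal. -/
theorem lintegral_norm_sq_sub_leftInv_le {p q : Type*} [Fintype p] [Fintype q] [DecidableEq p]
    {t s : ℕ} (hs : s + alpha 𝕜 < t) {V : Matrix p (Fin s) 𝕜} (hV : Vᴴ * V = 1)
    (M : Matrix p q 𝕜) :
    ∫⁻ G, ENNReal.ofReal (‖M - V * (leftInv (G * V) * (G * M))‖ ^ 2)
        ∂stdNormalMatrix 𝕜 (Fin t) p ≤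
      ENNReal.ofReal ((1 + ratio 𝕜 s t) * ‖M - V * (Vᴴ * M)‖ ^ 2) := by
  set C := M - V * (Vᴴ * M) with hC
  have hm : Measurable fun G : Matrix (Fin t) p 𝕜 =>
      ENNReal.ofReal (‖leftInv (G * V) * (G * C)‖ ^ 2) :=
    (((measurable_leftInv.comp (measurable_id.matrix_mul measurable_const)).matrix_mul
      (measurable_id.matrix_mul measurable_const)).frobenius_norm.pow_const 2).ennreal_ofReal
  have h0 := conjTranspose_mul_residual hV M
  have hae : ∀ᵐ (G : Matrix (Fin t) p 𝕜) ∂stdNormalMatrix 𝕜 (Fin t) p,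
      ENNReal.ofReal (‖M - V * (leftInv (G * V) * (G * M))‖ ^ 2) =
        ENNReal.ofReal (‖C‖ ^ 2) + ENNReal.ofReal (‖leftInv (G * V) * (G * C)‖ ^ 2) := by
    filter_upwards [ae_det_mul_ne_zero hs hV] with G hG
    rw [← ENNReal.ofReal_add (sq_nonneg _) (sq_nonneg _),
      ← norm_sq_sub_mul_of_orthogonal hV h0]
    have : leftInv (G * V) * (G * M) = leftInv (G * V) * (G * C) + Vᴴ * M := by
      rw [hC, Matrix.mul_sub, Matrix.mul_sub, ← Matrix.mul_assoc G V, ← Matrix.mul_assoc _ (G * V),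
        leftInv_mul_self hG, Matrix.one_mul, sub_add_cancel]
    rw [this, Matrix.mul_add, hC]
    congr 3
    abel
  rw [lintegral_congr_ae hae, lintegral_add_right _ hm, lintegral_const, measure_univ, mul_one,
    add_mul, one_mul, ENNReal.ofReal_add (sq_nonneg _)
      (mul_nonneg (ratio_nonneg hs) (sq_nonneg _))]
  gcongr
  exact lintegral_norm_sq_leftInv_mul_le hs hV h0

open scoped ComplexOrder in
theorem lintegral_norm_sq_rangeFinder_le {m n k : ℕ} (A : Matrix (Fin m) (Fin n) 𝕜)
    {qr : Matrix (Fin m) (Fin k) 𝕜 → Matrix (Fin m) (Fin k) 𝕜}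
    (hqr : ∀ Y, IsOrthoFactor Y (qr Y)) {ρ : ℕ} (hρ : ρ + alpha 𝕜 < k)
    {B : Matrix (Fin m) (Fin n) 𝕜} (hB : B.rank ≤ ρ) :
    ∫⁻ G, ENNReal.ofReal (‖A - qr (A * G) * ((qr (A * G))ᴴ * A)‖ ^ 2)
        ∂stdNormalMatrix 𝕜 (Fin n) (Fin k) ≤
      ENNReal.ofReal ((1 + ratio 𝕜 ρ k) * ‖A - B‖ ^ 2) := by
  obtain ⟨d, V, Z, hd, hV, hBZ⟩ := exists_isometry_mul_eq Bᴴ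
  rw [Matrix.rank_conjTranspose] at hd
  have hd' : d + alpha 𝕜 < k := by omega
  have hF : Measurable fun G : Matrix (Fin k) (Fin n) 𝕜 =>
      ENNReal.ofReal (‖Aᴴ - V * (leftInv (G * V) * (G * Aᴴ))‖ ^ 2) :=
    ((measurable_const.matrix_sub (measurable_const.matrix_mul ((measurable_leftInv.comp
      (measurable_id.matrix_mul measurable_const)).matrix_mul
      (measurable_id.matrix_mul measurable_const)))).frobenius_norm.pow_const 2).ennreal_ofReal
  have h1 := lintegral_norm_sq_sub_leftInv_le hd' hV Aᴴ
  have hT : Measurable (Matrix.conjTranspose : Matrix (Fin n) (Fin k) 𝕜 → _) :=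
    Measurable.matrix_conjTranspose measurable_id
  rw [← map_conjTranspose_stdNormalMatrix, lintegral_map hF hT] at h1
  refine le_trans (lintegral_mono fun G => ENNReal.ofReal_le_ofReal ?_)
    (h1.trans (ENNReal.ofReal_le_ofReal ?_))
  · refine pow_le_pow_left₀ (norm_nonneg _) ?_ 2
    obtain ⟨hQ, R, -, hR⟩ := hqr (A * G)
    set L := leftInv (Gᴴ * V)
    rw [← Matrix.frobenius_norm_conjTranspose (Aᴴ - _), Matrix.conjTranspose_sub,
      Matrix.conjTranspose_conjTranspose]
    -- The transposed least-squares fit of Aᴴ has columns in the range of AG, hence of Q, so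
    -- projecting A onto that range does at least as well.
    have : (V * (L * (Gᴴ * Aᴴ)))ᴴ = qr (A * G) * (R * (V * L)ᴴ) := by
      rw [← Matrix.mul_assoc _ R, ← hR, ← Matrix.mul_assoc V, Matrix.conjTranspose_mul,
        ← Matrix.conjTranspose_mul A, Matrix.conjTranspose_conjTranspose]
    rw [this]
    exact norm_residual_le hQ A _
  · have h2 : ‖Aᴴ - V * (Vᴴ * Aᴴ)‖ ≤ ‖A - B‖ := by
      rw [← Matrix.frobenius_norm_conjTranspose (A - B), Matrix.conjTranspose_sub, hBZ]
      exact norm_residual_le hV Aᴴ Z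
    have h4 := ratio_nonneg hd'
    have h5 := ratio_mono (hd.trans hB) hρ
    exact mul_le_mul (by linarith) (pow_le_pow_left₀ (norm_nonneg _) h2 2) (sq_nonneg _)
      (by linarith)

theorem IsBestRankApprox.isometry_mul {m n k r : ℕ} {Q : Matrix (Fin m) (Fin k) 𝕜}
    (hQ : Qᴴ * Q = 1) {X Xr : Matrix (Fin k) (Fin n) 𝕜} (h : IsBestRankApprox r X Xr) :
    IsBestRankApprox r (Q * X) (Q * Xr) := by
  refine ⟨(Matrix.rank_mul_le_right _ _).trans h.1, fun C hC => ?_⟩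
  rw [← Matrix.mul_sub, norm_isometry_mul hQ, norm_sub_rev (Q * X)]
  exact (h.2 (Qᴴ * C) ((Matrix.rank_mul_le_right _ _).trans hC)).trans
    (norm_sub_conjTranspose_mul_le hQ C X)

theorem IsBestRankApprox.norm_sub_le {m n r : ℕ} {A M M' B : Matrix (Fin m) (Fin n) 𝕜}
    (h : IsBestRankApprox r M M') (hB : B.rank ≤ r) : ‖A - M'‖ ≤ ‖A - B‖ + 2 * ‖A - M‖ := by
  have h1 := norm_sub_le_norm_sub_add_norm_sub A M M'
  have h2 := norm_sub_le_norm_sub_add_norm_sub M A B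
  have h3 := h.2 B hB
  rw [norm_sub_rev M A] at h2
  linarith

/-- Passes a bound uniform in B to the infimum, so no minimizer has to be produced. -/
theorem le_tailEnergy {m n j : ℕ} (hj : 0 < j) {A : Matrix (Fin m) (Fin n) 𝕜} {x : ℝ}
    (h : ∀ B : Matrix (Fin m) (Fin n) 𝕜, B.rank < j → x ≤ ‖A - B‖) : x ≤ tailEnergy j A := by
  rcases le_or_gt x 0 with hx | hx
  · exact hx.trans (Real.sqrt_nonneg _)
  · have : Nonempty {B : Matrix (Fin m) (Fin n) 𝕜 // B.rank < j} := ⟨⟨0, by simpa using hj⟩⟩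
    refine Real.le_sqrt_of_sq_le (le_ciInf fun B => ?_)
    exact pow_le_pow_left₀ hx.le (h B.1 B.2) 2

/-- Jensen's inequality in the form of nonnegative variance. -/
theorem integral_le_of_lintegral_sq_le {S : Type*} [MeasurableSpace S] {μ : Measure S}
    [IsProbabilityMeasure μ] {Z : S → ℝ} (hZ : AEMeasurable Z μ) {c : ℝ} (hc : 0 ≤ c)
    (h : ∫⁻ s, ENNReal.ofReal (Z s ^ 2) ∂μ ≤ ENNReal.ofReal (c ^ 2)) :
    Integrable Z μ ∧ ∫ s, Z s ∂μ ≤ c := by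
  have hi : Integrable (fun s => Z s ^ 2) μ := by
    refine ⟨(hZ.pow_const 2).aestronglyMeasurable, ?_⟩
    rw [hasFiniteIntegral_iff_ofReal (ae_of_all _ fun s => sq_nonneg _)]
    exact h.trans_lt ENNReal.ofReal_lt_top
  have hL : MemLp Z 2 μ := (memLp_two_iff_integrable_sq hZ.aestronglyMeasurable).2 hi
  refine ⟨hL.integrable one_le_two, ?_⟩
  rw [← ofReal_integral_eq_lintegral_ofReal hi (ae_of_all _ fun s => sq_nonneg _),
    ENNReal.ofReal_le_ofReal_iff (sq_nonneg _)] at h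
  have hv := variance_eq_sub hL
  have hv' := variance_nonneg Z μ
  simp only [Pi.pow_apply] at hv
  exact (le_abs_self _).trans (abs_le_of_sq_le_sq (by linarith) hc)

end Expectation

/-! ### Combining the two stages over the product law -/

section Sketch

variable {𝕜 : Type*} [RCLike 𝕜] {m n k l : ℕ}

/-- The reconstruction error, as a function of the two test matrices. -/
noncomputable def sketchError (A : Matrix (Fin m) (Fin n) 𝕜)
    (qr : Matrix (Fin m) (Fin k) 𝕜 → Matrix (Fin m) (Fin k) 𝕜)
    (x : Matrix (Fin n) (Fin k) 𝕜 × Matrix (Fin l) (Fin m) 𝕜) : ℝ :=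
  ‖A - qr (A * x.1) * (leftInv (x.2 * qr (A * x.1)) * (x.2 * A))‖

theorem measurable_qr_mul (A : Matrix (Fin m) (Fin n) 𝕜)
    {qr : Matrix (Fin m) (Fin k) 𝕜 → Matrix (Fin m) (Fin k) 𝕜} (hqr : Measurable qr) :
    Measurable fun x : Matrix (Fin n) (Fin k) 𝕜 × Matrix (Fin l) (Fin m) 𝕜 => qr (A * x.1) :=
  hqr.comp (measurable_const.matrix_mul measurable_fst)

theorem measurable_sketchError (A : Matrix (Fin m) (Fin n) 𝕜)
    {qr : Matrix (Fin m) (Fin k) 𝕜 → Matrix (Fin m) (Fin k) 𝕜} (hqr : Measurable qr) :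
    Measurable (sketchError (l := l) A qr) := by
  have hQ := measurable_qr_mul (l := l) A hqr
  exact (measurable_const.matrix_sub (hQ.matrix_mul ((measurable_leftInv.comp
    (measurable_snd.matrix_mul hQ)).matrix_mul
    (measurable_snd.matrix_mul measurable_const)))).frobenius_norm

theorem lintegral_sketchError_sq_le (A : Matrix (Fin m) (Fin n) 𝕜)
    {qr : Matrix (Fin m) (Fin k) 𝕜 → Matrix (Fin m) (Fin k) 𝕜} (hqr_meas : Measurable qr)
    (hqr : ∀ Y, IsOrthoFactor Y (qr Y)) (hl : k + alpha 𝕜 < l) {ρ : ℕ} (hρ : ρ + alpha 𝕜 < k)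
    {B : Matrix (Fin m) (Fin n) 𝕜} (hB : B.rank ≤ ρ) :
    ∫⁻ x, ENNReal.ofReal (sketchError A qr x ^ 2)
        ∂(stdNormalMatrix 𝕜 (Fin n) (Fin k)).prod (stdNormalMatrix 𝕜 (Fin l) (Fin m)) ≤
      ENNReal.ofReal ((√(1 + ratio 𝕜 k l) * √(1 + ratio 𝕜 ρ k) * ‖A - B‖) ^ 2) := by
  have h1 : 0 ≤ 1 + ratio 𝕜 k l := by have := ratio_nonneg hl; positivity
  have h2 : 0 ≤ 1 + ratio 𝕜 ρ k := by have := ratio_nonneg hρ; positivity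
  have hQ : Measurable fun G : Matrix (Fin n) (Fin k) 𝕜 => qr (A * G) :=
    hqr_meas.comp (measurable_const.matrix_mul measurable_id)
  have hm : Measurable fun G : Matrix (Fin n) (Fin k) 𝕜 =>
      ENNReal.ofReal (‖A - qr (A * G) * ((qr (A * G))ᴴ * A)‖ ^ 2) :=
    ((measurable_const.matrix_sub (hQ.matrix_mul (hQ.matrix_conjTranspose.matrix_mul
      measurable_const))).frobenius_norm.pow_const 2).ennreal_ofReal
  rw [lintegral_prod _
    ((measurable_sketchError A hqr_meas).pow_const 2).ennreal_ofReal.aemeasurable]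
  -- For fixed first test matrix, Q is a deterministic isometry and the second test matrix is still
  -- Gaussian.
  refine (lintegral_mono fun G =>
    lintegral_norm_sq_sub_leftInv_le hl (hqr (A * G)).1 A).trans ?_
  simp_rw [ENNReal.ofReal_mul h1]
  rw [lintegral_const_mul _ hm, mul_pow, mul_pow, Real.sq_sqrt h1, Real.sq_sqrt h2, mul_assoc,
    ENNReal.ofReal_mul h1]
  gcongr
  exact lintegral_norm_sq_rangeFinder_le A hqr hρ hB

theorem ae_det_sketch_ne_zero (A : Matrix (Fin m) (Fin n) 𝕜)
    {qr : Matrix (Fin m) (Fin k) 𝕜 → Matrix (Fin m) (Fin k) 𝕜} (hqr_meas : Measurable qr)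
    (hqr : ∀ Y, IsOrthoFactor Y (qr Y)) (hl : k + alpha 𝕜 < l) :
    ∀ᵐ (x : Matrix (Fin n) (Fin k) 𝕜 × Matrix (Fin l) (Fin m) 𝕜)
        ∂(stdNormalMatrix 𝕜 (Fin n) (Fin k)).prod (stdNormalMatrix 𝕜 (Fin l) (Fin m)),
      ((x.2 * qr (A * x.1))ᴴ * (x.2 * qr (A * x.1))).det ≠ 0 := by
  have hf : Measurable fun x : Matrix (Fin n) (Fin k) 𝕜 × Matrix (Fin l) (Fin m) 𝕜 =>
      x.2 * qr (A * x.1) := measurable_snd.matrix_mul (measurable_qr_mul A hqr_meas)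
  have hm : MeasurableSet {x : Matrix (Fin n) (Fin k) 𝕜 × Matrix (Fin l) (Fin m) 𝕜 |
      ((x.2 * qr (A * x.1))ᴴ * (x.2 * qr (A * x.1))).det ≠ 0} := hf measurableSet_det_ne_zero
  have hG : ∀ G : Matrix (Fin n) (Fin k) 𝕜, ∀ᵐ (H : Matrix (Fin l) (Fin m) 𝕜)
      ∂stdNormalMatrix 𝕜 (Fin l) (Fin m), ((H * qr (A * G))ᴴ * (H * qr (A * G))).det ≠ 0 :=
    fun G => ae_det_mul_ne_zero hl (hqr (A * G)).1
  exact (Measure.ae_prod_iff_ae_ae (p := fun x : Matrix (Fin n) (Fin k) 𝕜 ×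
    Matrix (Fin l) (Fin m) 𝕜 => ((x.2 * qr (A * x.1))ᴴ * (x.2 * qr (A * x.1))).det ≠ 0)
    hm).2 (ae_of_all _ hG)

end Sketch

end SketchRecon

/-! ### The fixed-rank error bound -/

theorem corollary6p2 {𝕜 : Type*} [RCLike 𝕜] {m n : ℕ} (A : Matrix (Fin m) (Fin n) 𝕜)
    (r k l : ℕ) (hk : r + alpha 𝕜 < k) (hl : k + alpha 𝕜 < l)
    {S : Type*} [MeasurableSpace S] (μ : Measure S) [IsProbabilityMeasure μ]
    (Ω : S → Matrix (Fin n) (Fin k) 𝕜) (Ψ : S → Matrix (Fin l) (Fin m) 𝕜)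
    (hΩ : IsStdNormalMatrix Ω μ) (hΨ : IsStdNormalMatrix Ψ μ) (hind : IndepFun Ω Ψ μ)
    (qr : Matrix (Fin m) (Fin k) 𝕜 → Matrix (Fin m) (Fin k) 𝕜) (hqr_meas : Measurable qr)
    (hqr : ∀ Y, IsOrthoFactor Y (qr Y))
    (Q : S → Matrix (Fin m) (Fin k) 𝕜) (hQ : ∀ s, Q s = qr (A * Ω s))
    (X : S → Matrix (Fin k) (Fin n) 𝕜) (hX : ∀ s, X s = factorX (Ψ s) (Q s) (Ψ s * A))
    (Xr : S → Matrix (Fin k) (Fin n) 𝕜) (hXr_meas : AEMeasurable Xr μ)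
    (hXr : ∀ s, IsBestRankApprox r (X s) (Xr s)) :
    (∀ s, IsBestRankApprox r (Q s * X s) (Q s * Xr s)) ∧
    Integrable (fun s => ‖A - Q s * Xr s‖) μ ∧
    ∫ s, ‖A - Q s * Xr s‖ ∂μ ≤
      tailEnergy (r + 1) A + 2 * √(1 + ratio 𝕜 k l) *
        ⨅ ρ : {ρ : ℕ // ρ + alpha 𝕜 < k}, √(1 + ratio 𝕜 ρ k) * tailEnergy (ρ + 1) A := by
  have hbest : ∀ s, IsBestRankApprox r (Q s * X s) (Q s * Xr s) := fun s =>
    (hXr s).isometry_mul (hQ s ▸ (hqr _).1)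
  have hΩl := hΩ.hasLaw_stdNormalMatrix
  have hΨl := hΨ.hasLaw_stdNormalMatrix
  have hp : AEMeasurable (fun s => (Ω s, Ψ s)) μ := hΩl.aemeasurable.prodMk hΨl.aemeasurable
  have hlaw := (indepFun_iff_map_prod_eq_prod_map_map hΩl.aemeasurable hΨl.aemeasurable).1 hind
  rw [hΩl.map_eq, hΨl.map_eq] at hlaw
  have herr_meas := measurable_sketchError (l := l) A hqr_meas
  -- Equality holds where ΨQ has full column rank, which is almost everywhere.
  have herr : (fun s => ‖A - Q s * X s‖) =ᵐ[μ] fun s => sketchError A qr (Ω s, Ψ s) := by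
    have h := ae_det_sketch_ne_zero (l := l) A hqr_meas hqr hl
    rw [← hlaw] at h
    filter_upwards [ae_of_ae_map hp h] with s hs
    rw [sketchError, hX, factorX, hQ, pinv_eq_leftInv hs]
  have herr_ae : AEMeasurable (fun s => ‖A - Q s * X s‖) μ :=
    (herr_meas.comp_aemeasurable hp).congr herr.symm
  have hsq : ∀ ρ, ρ + alpha 𝕜 < k → ∀ B : Matrix (Fin m) (Fin n) 𝕜, B.rank ≤ ρ →
      ∫⁻ s, ENNReal.ofReal (‖A - Q s * X s‖ ^ 2) ∂μ ≤
        ENNReal.ofReal ((√(1 + ratio 𝕜 k l) * √(1 + ratio 𝕜 ρ k) * ‖A - B‖) ^ 2) := by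
    intro ρ hρ B hB
    refine le_trans (le_of_eq ?_) (lintegral_sketchError_sq_le A hqr_meas hqr hl hρ hB)
    rw [← hlaw, lintegral_map' (herr_meas.pow_const 2).ennreal_ofReal.aemeasurable hp]
    refine lintegral_congr_ae ?_
    filter_upwards [herr] with s hs
    rw [hs]
  have hmean := fun ρ hρ B hB =>
    integral_le_of_lintegral_sq_le herr_ae (by positivity) (hsq ρ hρ B hB)
  have hint : Integrable (fun s => ‖A - Q s * X s‖) μ := (hmean r hk 0 (by simp)).1
  have hbound : ∀ B : Matrix (Fin m) (Fin n) 𝕜, B.rank ≤ r → ∀ s,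
      ‖A - Q s * Xr s‖ ≤ ‖A - B‖ + 2 * ‖A - Q s * X s‖ :=
    fun B hB s => (hbest s).norm_sub_le hB
  have hint' : Integrable (fun s => ‖A - Q s * Xr s‖) μ := by
    refine Integrable.mono' ((integrable_const ‖A - 0‖).add (hint.const_mul 2)) ?_
      (ae_of_all _ fun s => ?_)
    · have hx : Measurable fun x : Matrix (Fin n) (Fin k) 𝕜 × Matrix (Fin k) (Fin n) 𝕜 =>
          ‖A - qr (A * x.1) * x.2‖ :=
        (measurable_const.matrix_sub ((hqr_meas.comp
          (measurable_const.matrix_mul measurable_fst)).matrix_mul measurable_snd)).frobenius_norm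
      simp_rw [hQ]
      exact (hx.comp_aemeasurable (hΩl.aemeasurable.prodMk hXr_meas)).aestronglyMeasurable
    · rw [Real.norm_of_nonneg (norm_nonneg _)]
      exact hbound 0 (by simp) s
  refine ⟨hbest, hint', ?_⟩
  have h1 : 0 < √(1 + ratio 𝕜 k l) := Real.sqrt_pos.2 (by linarith [ratio_nonneg hl])
  have hfirst : ∫ s, ‖A - Q s * Xr s‖ ∂μ ≤
      tailEnergy (r + 1) A + 2 * ∫ s, ‖A - Q s * X s‖ ∂μ := by
    -- Isolating the tail energy lets the bound be proved for each competitor B separately.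
    rw [← sub_le_iff_le_add]
    refine le_tailEnergy r.succ_pos fun B hB => ?_
    rw [sub_le_iff_le_add]
    refine (integral_mono hint' ((integrable_const _).add (hint.const_mul 2))
      (hbound B (by omega))).trans (le_of_eq ?_)
    simp only [Pi.add_apply]
    rw [integral_add (integrable_const _) (hint.const_mul 2), integral_const_mul]
    simp
  have hsecond : ∫ s, ‖A - Q s * X s‖ ∂μ ≤ √(1 + ratio 𝕜 k l) *
      ⨅ ρ : {ρ : ℕ // ρ + alpha 𝕜 < k}, √(1 + ratio 𝕜 ρ k) * tailEnergy (ρ + 1) A := by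
    have : Nonempty {ρ : ℕ // ρ + alpha 𝕜 < k} := ⟨⟨r, hk⟩⟩
    rw [← div_le_iff₀' h1]
    refine le_ciInf fun ρ => ?_
    have h2 : 0 < √(1 + ratio 𝕜 ρ k) := Real.sqrt_pos.2 (by linarith [ratio_nonneg ρ.2])
    rw [← div_le_iff₀' h2]
    refine le_tailEnergy ρ.1.succ_pos fun B hB => ?_
    rw [div_le_iff₀' h2, div_le_iff₀' h1, ← mul_assoc]
    exact (hmean ρ ρ.2 B (by omega)).2
  linarith
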